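/- Let $n\ge 1$. There is a constant $C(n)$, depending only on $n$, such that the following holds. Let $\mathcal D$ be a dyadic grid on $\mathbb R^n$ (cubes are half-open), let $1<p<\infty$, let $\mu,\lambda\in A_p^{\mathcal D}$ be dyadic $A_p$ weights, i.e. locally integrable, a.e. positive functions $w$ with $\sup_{Q\in\mathcal D}\langle w\rangle_Q\langle w^{1-p'}\rangle_Q^{p-1}<\infty$, where $\langle f\rangle_Q=\frac1{|Q|}\int_Q f\,dx$ and $\frac1p+\frac1{p'}=1$, and put $\nu=\mu^{1/p}\lambda^{-1/p}$. Let $\Lambda>1$ and let $b\in BMO^{\mathcal D}(\nu)$, i.e. $b$ is real, locally integrable and $\|b\|_{BMO^{\mathcal D}(\nu)}=\sup_{Q\in\mathcal D}\frac1{\nu(Q)}\int_Q|b-\langle b\rangle_Q|\,dx<\infty$. Then $$\|\Pi_b:L^p(\mu)\to L^p(\lambda)\|\le C(n)\,\|b\|_{BMO^{\mathcal D}(\nu)}\ \sup_{\mathcal S}\Big(\frac{\Lambda}{\Lambda-1}\Big)^2\|\mathcal A^\nu_{\mathcal S}:L^p(\mu)\to L^p(\lambda)\|,$$ where the supremum is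 over all sparse collections $\mathcal S\subset\mathcal D$ which have no infinitely increasing chain and whose Carleson constant $\sup_{Q\in\mathcal D}\frac1{|Q|}\sum_{P\in\mathcal S,\,P\subset Q}|P|$ equals $\Lambda$. The same bound holds with $\Pi_b$ replaced by $\Pi_b^*$ and by $\Gamma_b$. Here $\mathcal S$ is sparse if for some $\eta\in(0,1)$ there are pairwise disjoint measurable sets $E_Q\subset Q$ $(Q\in\mathcal S)$ with $|E_Q|\ge\eta|Q|$; an infinitely increasing chain is a sequence $Q_k\in\mathcal S$ with $Q_k\subsetneq Q_{k+1}$ for all $k\in\mathbb N$; and $\mathcal A^\nu_{\mathcal S}f=\sum_{Q\in\mathcal S}\langle\nu\rangle_Q\langle f\rangle_Q\mathbf 1_Q$. For an interval $I$ let $h_I^0=|I|^{-1/2}(\mathbf 1_{I_+}-\mathbf 1_{I_-})$ ($I_\pm$ the right and left halves) and $h_I^1=|I|^{-1/2}\mathbf 1_I$; for $Q=I_1\times\dots\times I_n$ and $\epsilon\in\{0,1\}^n$ let $h_Q^\epsilon(x)=\prod_k h_{I_k}^{\epsilon_k}(x_k)$. With $(f,g)=\int fg\,dx$, $$\Pi_bf=\sum_{Q\in\mathcal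 D,\ \epsilon\not\equiv1}(b,h_Q^\epsilon)\langle f\rangle_Q h_Q^\epsilon,\qquad \Pi_b^*f=\sum_{Q\in\mathcal D,\ \epsilon\not\equiv1}(b,h_Q^\epsilon)(f,h_Q^\epsilon)\frac{\mathbf 1_Q}{|Q|},$$ $$\Gamma_bf=\sum_{Q\in\mathcal D}\ \sum_{\epsilon,\eta\not\equiv1,\ \epsilon\ne\eta}(b,h_Q^\epsilon)(f,h_Q^\eta)\frac1{\sqrt{|Q|}}h_Q^{\epsilon+\eta},$$ where $(\epsilon+\eta)_k=1$ if $\epsilon_k=\eta_k$ and $0$ otherwise (so $h_Q^\epsilon h_Q^\eta=|Q|^{-1/2}h_Q^{\epsilon+\eta}$). The operators act on real functions; each series is understood as an unconditionally convergent series in $L^p(\lambda)$, and the operator norm in $[0,\infty]$ is the least $K$ such that for every $f\in L^p(\mu)$ the series converges with sum of $L^p(\lambda)$-norm at most $K\|f\|_{L^p(\mu)}$ ($\infty$ if there is none). -/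

import Mathlib

noncomputable section

namespace BloomParaproduct

open MeasureTheory Filter Topology
open scoped ENNReal NNReal

/-! ### Dyadic cubes and dyadic grids -/

/-- The half-open cube `∏ i, [corner i, corner i + 2 ^ scale)` in `ℝⁿ`. -/
structure Cube (n : ℕ) where
  corner : Fin n → ℝ
  scale : ℤ

/-- The side length `2 ^ k`. -/
def Cube.side {n : ℕ} (Q : Cube n) : ℝ := (2 : ℝ) ^ Q.scale

/-- The set of points of a cube. -/
def Cube.toSet {n : ℕ} (Q : Cube n) : Set (Fin n → ℝ) :=
  {x | ∀ i, x i ∈ Set.Ico (Q.corner i) (Q.corner i + Q.side)}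

/-- A dyadic grid on `ℝⁿ`: a collection of cubes with side lengths `2 ^ k`, `k ∈ ℤ`, such that for
each `k` the cubes of side length `2 ^ k` partition `ℝⁿ`, and such that the intersection of any two
of its cubes is one of them or empty. -/
structure DyadicGrid (n : ℕ) where
  cubes : Set (Cube n)
  partition : ∀ (k : ℤ) (x : Fin n → ℝ), ∃! Q : Cube n, Q ∈ cubes ∧ Q.scale = k ∧ x ∈ Q.toSet
  nested : ∀ P ∈ cubes, ∀ Q ∈ cubes, P.toSet ∩ Q.toSet = P.toSet ∨
    P.toSet ∩ Q.toSet = Q.toSet ∨ P.toSet ∩ Q.toSet = ∅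

/-! ### Haar functions -/

/-- Signatures; in each coordinate `0` is cancellative and `1` is non-cancellative. -/
abbrev Signature (n : ℕ) : Type := Fin n → Fin 2

/-- A signature is cancellative if it is not identically `1`. -/
def Signature.Cancellative {n : ℕ} (e : Signature n) : Prop := e ≠ fun _ => 1

/-- The two Haar functions of the interval `I = [a, a + l)`: for `e = 0` it is
`|I|^(-1/2) (1_{right half} - 1_{left half})`, for `e = 1` it is `|I|^(-1/2) 1_I`. -/
def haarInterval (e : Fin 2) (a l x : ℝ) : ℝ :=
  if e = 0 then
    (Real.sqrt l)⁻¹ * ((Set.Ico (a + l / 2) (a + l)).indicator (fun _ => (1 : ℝ)) x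
      - (Set.Ico a (a + l / 2)).indicator (fun _ => (1 : ℝ)) x)
  else
    (Real.sqrt l)⁻¹ * (Set.Ico a (a + l)).indicator (fun _ => (1 : ℝ)) x

/-- The Haar function `h_Q^ε`. -/
def haar {n : ℕ} (Q : Cube n) (e : Signature n) (x : Fin n → ℝ) : ℝ :=
  ∏ i, haarInterval (e i) (Q.corner i) Q.side (x i)

/-- The signature `ε + η` for which `h_Q^ε h_Q^η = |Q|^(-1/2) h_Q^(ε + η)`
(see `haar_mul_haar`). It is not the coordinatewise sum modulo `2`. -/
def sigAdd {n : ℕ} (e d : Signature n) : Signature n := fun i => if e i = d i then 1 else 0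

/-- The Lebesgue measure `|Q|` of a cube. -/
def vol {n : ℕ} (Q : Cube n) : ℝ := volume.real Q.toSet

theorem Cube.side_pos {n : ℕ} (Q : Cube n) : 0 < Q.side := by
  unfold Cube.side; positivity

theorem vol_eq {n : ℕ} (Q : Cube n) : vol Q = Q.side ^ n := by
  have h : Q.toSet = Set.pi Set.univ fun i => Set.Ico (Q.corner i) (Q.corner i + Q.side) := by
    ext x; simp [Cube.toSet]
  rw [vol, h, Measure.real, Real.volume_pi_Ico]
  simp [ENNReal.toReal_ofReal Q.side_pos.le]

theorem haarInterval_mul (e d : Fin 2) (a l x : ℝ) :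
    haarInterval e a l x * haarInterval d a l x =
      (Real.sqrt l)⁻¹ * haarInterval (if e = d then 1 else 0) a l x := by
  fin_cases e <;> fin_cases d <;>
    simp only [haarInterval, Set.indicator_apply, Set.mem_Ico] <;>
    simp <;> grind

/-- The product rule that the signature `sigAdd` encodes. -/
theorem haar_mul_haar {n : ℕ} (Q : Cube n) (e d : Signature n) (x : Fin n → ℝ) :
    haar Q e x * haar Q d x = (Real.sqrt (vol Q))⁻¹ * haar Q (sigAdd e d) x := by
  have hs : Real.sqrt (vol Q) = Real.sqrt Q.side ^ n := by
    rw [vol_eq, Real.sqrt_eq_iff_mul_self_eq (by have := Q.side_pos; positivity) (by positivity),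
      ← mul_pow, Real.mul_self_sqrt Q.side_pos.le]
  rw [hs]
  simp only [haar, ← Finset.prod_mul_distrib, haarInterval_mul, sigAdd]
  simp [Finset.prod_mul_distrib]

/-! ### Averages, weights, BMO -/

/-- The average `⟨f⟩_Q`. -/
def avg {n : ℕ} (f : (Fin n → ℝ) → ℝ) (Q : Cube n) : ℝ := ⨍ x in Q.toSet, f x

/-- The pairing `(f, g) = ∫ f g dx`. -/
def pairing {n : ℕ} (f g : (Fin n → ℝ) → ℝ) : ℝ := ∫ x, f x * g x

/-- A weight: a locally integrable, almost everywhere positive function. -/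
def IsWeight {n : ℕ} (w : (Fin n → ℝ) → ℝ) : Prop :=
  LocallyIntegrable w volume ∧ ∀ᵐ x, 0 < w x

/-- The measure `w dx`. -/
def wMeasure {n : ℕ} (w : (Fin n → ℝ) → ℝ) : Measure (Fin n → ℝ) :=
  volume.withDensity fun x => ENNReal.ofReal (w x)

/-- The conjugate weight `w' = w ^ (1 - p')`, where `1 / p + 1 / p' = 1`. -/
def conjWeight {n : ℕ} (p : ℝ) (w : (Fin n → ℝ) → ℝ) (x : Fin n → ℝ) : ℝ :=
  w x ^ (1 - Real.conjExponent p)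

/-- The dyadic `A_p` characteristic `sup_{Q ∈ D} ⟨w⟩_Q ⟨w'⟩_Q ^ (p - 1)`. -/
def apChar {n : ℕ} (D : DyadicGrid n) (p : ℝ) (w : (Fin n → ℝ) → ℝ) : ℝ≥0∞ :=
  ⨆ Q ∈ D.cubes, ((∫⁻ x in Q.toSet, ENNReal.ofReal (w x)) / volume Q.toSet) *
    ((∫⁻ x in Q.toSet, ENNReal.ofReal (conjWeight p w x)) / volume Q.toSet) ^ (p - 1)

/-- `w` is a dyadic `A_p` weight. -/
def IsApWeight {n : ℕ} (D : DyadicGrid n) (p : ℝ) (w : (Fin n → ℝ) → ℝ) : Prop :=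
  IsWeight w ∧ apChar D p w < ∞

/-- The Bloom weight `ν = μ ^ (1 / p) λ ^ (-1 / p)`. -/
def bloomWeight {n : ℕ} (p : ℝ) (mu lam : (Fin n → ℝ) → ℝ) (x : Fin n → ℝ) : ℝ :=
  mu x ^ (1 / p) * lam x ^ (-(1 / p))

/-- The norm `sup_{Q ∈ D} w(Q)⁻¹ ∫_Q |b - ⟨b⟩_Q| dx` of the dyadic weighted space `BMO^D(w)`. -/
def bmoNorm {n : ℕ} (D : DyadicGrid n) (w b : (Fin n → ℝ) → ℝ) : ℝ≥0∞ :=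
  ⨆ Q ∈ D.cubes, (∫⁻ x in Q.toSet, ENNReal.ofReal |b x - avg b Q|) / wMeasure w Q.toSet

/-- `b ∈ BMO^D(w)`. -/
def MemBMO {n : ℕ} (D : DyadicGrid n) (w b : (Fin n → ℝ) → ℝ) : Prop :=
  LocallyIntegrable b volume ∧ bmoNorm D w b < ∞

/-! ### Operators given by series, and their norms -/

/-- The series `∑ i, u i` converges unconditionally in `L^q(m)` to `g`. -/
def HasLpSum {E ι : Type} [MeasurableSpace E] (m : Measure E) (q : ℝ≥0∞) (u : ι → E → ℝ)
    (g : E → ℝ) : Prop :=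
  MemLp g q m ∧ Tendsto (fun F : Finset ι => eLpNorm (fun x => (∑ i ∈ F, u i x) - g x) q m)
    atTop (𝓝 0)

/-- The norm `‖T : L^p(μ) → L^p(λ)‖ ∈ [0, ∞]` of the operator `T f = ∑ i, t i f`, with the series
converging unconditionally in `L^p(λ)`: the least `K` such that for each `f ∈ L^p(μ)` the series
converges, to a function of norm at most `K ‖f‖`. It is `∞` if there is no such `K`; in particular
it is `∞` if the series fails to converge for some `f ∈ L^p(μ)`. -/
def opNorm {n : ℕ} {ι : Type} (p : ℝ) (mu lam : (Fin n → ℝ) → ℝ)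
    (t : ι → ((Fin n → ℝ) → ℝ) → (Fin n → ℝ) → ℝ) : ℝ≥0∞ :=
  sInf {K : ℝ≥0∞ | ∀ f : (Fin n → ℝ) → ℝ, MemLp f (ENNReal.ofReal p) (wMeasure mu) →
    ∃ g : (Fin n → ℝ) → ℝ,
      HasLpSum (wMeasure lam) (ENNReal.ofReal p) (fun i => t i f) g ∧
      eLpNorm g (ENNReal.ofReal p) (wMeasure lam) ≤
        K * eLpNorm f (ENNReal.ofReal p) (wMeasure mu)}

/-- Indices `(Q, ε)` with `Q ∈ D` and `ε ≢ 1`. -/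
abbrev HaarIndex {n : ℕ} (D : DyadicGrid n) : Type :=
  D.cubes × {e : Signature n // e.Cancellative}

/-- Indices `(Q, (ε, η))` with `Q ∈ D`, `ε, η ≢ 1` and `ε ≠ η`. -/
abbrev HaarPairIndex {n : ℕ} (D : DyadicGrid n) : Type :=
  D.cubes × {e : Signature n × Signature n //
    e.1.Cancellative ∧ e.2.Cancellative ∧ e.1 ≠ e.2}

/-- `Π_b f = ∑_{Q, ε} (b, h_Q^ε) ⟨f⟩_Q h_Q^ε`. -/
def paraPi {n : ℕ} (D : DyadicGrid n) (b : (Fin n → ℝ) → ℝ) (i : HaarIndex D)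
    (f : (Fin n → ℝ) → ℝ) (x : Fin n → ℝ) : ℝ :=
  pairing b (haar i.1.1 i.2.1) * avg f i.1.1 * haar i.1.1 i.2.1 x

/-- `Π_b^* f = ∑_{Q, ε} (b, h_Q^ε) (f, h_Q^ε) 1_Q / |Q|`. -/
def paraPiStar {n : ℕ} (D : DyadicGrid n) (b : (Fin n → ℝ) → ℝ) (i : HaarIndex D)
    (f : (Fin n → ℝ) → ℝ) (x : Fin n → ℝ) : ℝ :=
  pairing b (haar i.1.1 i.2.1) * pairing f (haar i.1.1 i.2.1) *
    (i.1.1.toSet.indicator (fun _ => (1 : ℝ)) x / vol i.1.1)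

/-- `Γ_b f = ∑_Q ∑_{ε, η ≢ 1, ε ≠ η} (b, h_Q^ε) (f, h_Q^η) |Q|^(-1/2) h_Q^(ε + η)`. -/
def paraGamma {n : ℕ} (D : DyadicGrid n) (b : (Fin n → ℝ) → ℝ) (i : HaarPairIndex D)
    (f : (Fin n → ℝ) → ℝ) (x : Fin n → ℝ) : ℝ :=
  pairing b (haar i.1.1 i.2.1.1) * pairing f (haar i.1.1 i.2.1.2) *
    ((Real.sqrt (vol i.1.1))⁻¹ * haar i.1.1 (sigAdd i.2.1.1 i.2.1.2) x)

/-- `A_S^w f = ∑_{Q ∈ S} ⟨w⟩_Q ⟨f⟩_Q 1_Q`. -/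
def sparseOp {n : ℕ} (w : (Fin n → ℝ) → ℝ) (S : Set (Cube n)) (Q : S)
    (f : (Fin n → ℝ) → ℝ) (x : Fin n → ℝ) : ℝ :=
  avg w Q.1 * avg f Q.1 * Q.1.toSet.indicator (fun _ => (1 : ℝ)) x

/-! ### Sparse collections -/

/-- `S` is `η`-sparse for some `η ∈ (0, 1)`. -/
def IsSparse {n : ℕ} (S : Set (Cube n)) : Prop :=
  ∃ η : ℝ, 0 < η ∧ η < 1 ∧ ∃ E : Cube n → Set (Fin n → ℝ),
    (∀ Q ∈ S, MeasurableSet (E Q) ∧ E Q ⊆ Q.toSet ∧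
      ENNReal.ofReal η * volume Q.toSet ≤ volume (E Q)) ∧
    S.PairwiseDisjoint E

/-- The Carleson constant of `S ⊆ D`: the least `Λ` with
`∑_{P ∈ S, P ⊆ Q} |P| ≤ Λ |Q|` for all `Q ∈ D`. -/
def carlesonConst {n : ℕ} (D : DyadicGrid n) (S : Set (Cube n)) : ℝ≥0∞ :=
  ⨆ Q ∈ D.cubes, (∑' P : {P : Cube n // P ∈ S ∧ P.toSet ⊆ Q.toSet}, volume P.1.toSet) /
    volume Q.toSet

/-- The sparse collections in `D` without infinitely increasing chains. -/
def Upsilon {n : ℕ} (D : DyadicGrid n) : Set (Set (Cube n)) :=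
  {S | S ⊆ D.cubes ∧ IsSparse S ∧
    ¬ ∃ Q : ℕ → Cube n, ∀ k, Q k ∈ S ∧ (Q k).toSet ⊂ (Q (k + 1)).toSet}

/-- `sup (Λ / (Λ - 1))² ‖A_S^ν : L^p(μ) → L^p(λ)‖`, over all sparse collections `S` in `D` without
infinitely increasing chains and with Carleson constant `Λ`; here `ν` is the Bloom weight. -/
def sparseSup {n : ℕ} (D : DyadicGrid n) (p L : ℝ) (mu lam : (Fin n → ℝ) → ℝ) : ℝ≥0∞ :=
  ⨆ S ∈ {S | S ∈ Upsilon D ∧ carlesonConst D S = ENNReal.ofReal L},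
    ENNReal.ofReal ((L / (L - 1)) ^ 2) * opNorm p mu lam (sparseOp (bloomWeight p mu lam) S)

end BloomParaproduct

end

noncomputable section

namespace BloomParaproduct

open MeasureTheory Filter Topology
open scoped ENNReal NNReal

/-! ### Geometry of dyadic cubes -/

section Geometry

variable {n : ℕ}

/-! Write `osc f Q` for the quadratic mean over the children of `Q` of `⟨f⟩_child - ⟨f⟩_Q`. A
cancellative Haar coefficient of `f` is at most `|Q|^(1/2) osc f Q` (`abs_pairing_haar_le`), so
every summand of `Π_b^* f` and `Γ_b f` is at most `osc b Q * osc f Q * 1_Q` pointwise, and only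
finitely many signatures share a cube.

The core is `exists_sparse_domination`: for finitely many cubes and `0 < θ < 1`, the sum of `osc b Q
* osc g Q * 1_Q` is at most `16 * 2^n / θ²` times a sum of `⟨|b - ⟨b⟩_P|⟩_P ⟨|g|⟩_P 1_P` over a `(1
- θ)`-sparse subfamily. It is a stopping time argument: on a top cube `P`, stop where the square
function of `b - ⟨b⟩_P` or of `g` exceeds `4/θ` times its average up to a dimensional factor. By the
weak type (1,1) inequality (`measureReal_squareFunction_le`) this happens on at most the fraction
`θ` of `P`; before stopping, Cauchy–Schwarz bounds the sum. The choice `θ = 1 - 1/Λ` yields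
`(Λ/(Λ-1))²` and a `1/Λ`-sparse family, and the BMO condition replaces the oscillation of `b` by
`‖b‖ ⟨ν⟩_P`.

This family is finite with Carleson constant at most `Λ`, whereas the supremum asks for exactly `Λ`.
Since `A_S^ν |f|` has nonnegative terms, `S` may be enlarged: `exists_mem_upsilon_carlesonConst_eq`
adds, inside a cube disjoint from `S`, a self-similar family with Carleson constant `Λ`.

The resulting bounds are uniform over finite partial sums with arbitrary signs. In `L^p`, `1 < p <
∞`, this forces unconditional convergence, by uniform convexity (`exists_hasLpSum`).

The terms of `Π_b f` carry only `⟨f⟩_Q`, so `Π_b` is treated by duality: a signed partial sum `h` is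
tested against `g = h |h|^(p-2) λ`, the sparse domination is applied to `b` and `g`, and the sparse
form, symmetric in `f` and `g`, is rewritten as `∫ |g| A_S^ν |f|`. Hölder's inequality then gives
`‖h‖ ≤ C ‖A_S^ν |f|‖` in `L^p(λ)`, so the same operator norm `L^p(μ) → L^p(λ)` appears. The `A_p`
characteristics never enter quantitatively; they only provide local integrability. -/

theorem Cube.toSet_eq_pi (Q : Cube n) :
    Q.toSet = Set.pi Set.univ fun i => Set.Ico (Q.corner i) (Q.corner i + Q.side) := by
  ext x; simp [Cube.toSet]

theorem Cube.measurableSet (Q : Cube n) : MeasurableSet Q.toSet := by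
  rw [Q.toSet_eq_pi]
  exact MeasurableSet.univ_pi fun _ => measurableSet_Ico

theorem vol_pos (Q : Cube n) : 0 < vol Q := by
  rw [vol_eq]; exact pow_pos Q.side_pos n

theorem Cube.volume_eq (Q : Cube n) : volume Q.toSet = ENNReal.ofReal (vol Q) := by
  have : volume Q.toSet ≠ ∞ := by
    rw [Q.toSet_eq_pi, Real.volume_pi_Ico]
    exact ENNReal.prod_ne_top fun _ _ => ENNReal.ofReal_ne_top
  rw [vol, ofReal_measureReal this]

theorem Cube.volume_ne_top (Q : Cube n) : volume Q.toSet ≠ ∞ := by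
  rw [Q.volume_eq]; exact ENNReal.ofReal_ne_top

theorem Cube.volume_ne_zero (Q : Cube n) : volume Q.toSet ≠ 0 := by
  rw [Q.volume_eq]; simpa using vol_pos Q

theorem Cube.corner_mem (Q : Cube n) : Q.corner ∈ Q.toSet := fun i =>
  ⟨le_rfl, by linarith [Q.side_pos]⟩

theorem Cube.subset_Icc (Q : Cube n) : Q.toSet ⊆ Set.Icc Q.corner (fun i => Q.corner i + Q.side) :=
  fun _ hx => ⟨fun i => (hx i).1, fun i => (hx i).2.le⟩

theorem _root_.MeasureTheory.LocallyIntegrable.integrableOn_cube {f : (Fin n → ℝ) → ℝ}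
    (hf : LocallyIntegrable f volume) (Q : Cube n) : IntegrableOn f Q.toSet :=
  (hf.integrableOn_isCompact isCompact_Icc).mono_set Q.subset_Icc

theorem vol_mono {P Q : Cube n} (h : P.toSet ⊆ Q.toSet) : vol P ≤ vol Q :=
  measureReal_mono h Q.volume_ne_top

/-- Volumes compare side lengths only if `n ≠ 0`: in dimension zero all cubes are the same point and
scales carry no information. -/
theorem Cube.scale_le_of_subset (hn : n ≠ 0) {P Q : Cube n} (h : P.toSet ⊆ Q.toSet) :
    P.scale ≤ Q.scale := by
  have h1 := vol_mono h
  rw [vol_eq, vol_eq, pow_le_pow_iff_left₀ P.side_pos.le Q.side_pos.le hn] at h1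
  exact (zpow_le_zpow_iff_right₀ (by norm_num : (1 : ℝ) < 2)).1 h1

/-! ### Nestedness and countability in a dyadic grid. -/

namespace DyadicGrid

variable (D : DyadicGrid n)

theorem eq_of_scale_eq {P Q : Cube n} (hP : P ∈ D.cubes) (hQ : Q ∈ D.cubes)
    (h : P.scale = Q.scale) {x : Fin n → ℝ} (hxP : x ∈ P.toSet) (hxQ : x ∈ Q.toSet) : P = Q :=
  (D.partition Q.scale x).unique ⟨hP, h, hxP⟩ ⟨hQ, rfl, hxQ⟩

theorem subset_of_scale_le (hn : n ≠ 0) {P Q : Cube n} (hP : P ∈ D.cubes) (hQ : Q ∈ D.cubes)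
    (h : P.scale ≤ Q.scale) {x : Fin n → ℝ} (hxP : x ∈ P.toSet) (hxQ : x ∈ Q.toSet) :
    P.toSet ⊆ Q.toSet := by
  rcases D.nested P hP Q hQ with h1 | h1 | h1
  · exact Set.inter_eq_left.1 h1
  · have h2 : Q.toSet ⊆ P.toSet := Set.inter_eq_right.1 h1
    have h3 := Cube.scale_le_of_subset hn h2
    rw [D.eq_of_scale_eq hP hQ (le_antisymm h h3) hxP hxQ]
  · exact ((Set.disjoint_iff_inter_eq_empty.2 h1).le_bot ⟨hxP, hxQ⟩).elim

theorem eq_of_toSet_eq (hn : n ≠ 0) {P Q : Cube n} (hP : P ∈ D.cubes) (hQ : Q ∈ D.cubes)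
    (h : P.toSet = Q.toSet) : P = Q :=
  D.eq_of_scale_eq hP hQ (le_antisymm (Cube.scale_le_of_subset hn h.subset)
    (Cube.scale_le_of_subset hn h.symm.subset)) P.corner_mem (h ▸ P.corner_mem)

theorem scale_lt_of_ne (hn : n ≠ 0) {P Q : Cube n} (hP : P ∈ D.cubes) (hQ : Q ∈ D.cubes)
    (h : P.toSet ⊆ Q.toSet) (hne : P ≠ Q) : P.scale < Q.scale :=
  lt_of_le_of_ne (Cube.scale_le_of_subset hn h) fun hs =>
    hne (D.eq_of_scale_eq hP hQ hs P.corner_mem (h P.corner_mem))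

/-- Cubes of a fixed scale have disjoint nonempty open interiors in a separable space. Countability
is what allows measures of unions of cubes to be summed. -/
theorem countable : D.cubes.Countable := by
  have h : D.cubes ⊆ ⋃ k : ℤ, {Q ∈ D.cubes | Q.scale = k} := fun Q hQ => by simpa using hQ
  refine Set.Countable.mono h (Set.countable_iUnion fun k => ?_)
  have hd : {Q ∈ D.cubes | Q.scale = k}.PairwiseDisjoint (fun Q => interior Q.toSet) := by
    intro P hP Q hQ hne
    refine Set.disjoint_left.2 fun x hx hy => hne ?_
    exact D.eq_of_scale_eq hP.1 hQ.1 (hP.2.trans hQ.2.symm) (interior_subset hx)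
      (interior_subset hy)
  refine hd.countable_of_isOpen (fun Q _ => isOpen_interior) fun Q _ => ?_
  rw [Q.toSet_eq_pi, interior_pi_set Set.finite_univ]
  refine ⟨fun i => Q.corner i + Q.side / 2, fun i _ => ?_⟩
  dsimp only
  rw [interior_Ico]
  have := Q.side_pos
  constructor <;> linarith

end DyadicGrid

/-- The dyadic child of `Q` in the orthant given by `s`. -/
def Cube.child (Q : Cube n) (s : Signature n) : Cube n :=
  ⟨fun i => Q.corner i + if s i = 1 then Q.side / 2 else 0, Q.scale - 1⟩

theorem Cube.side_child (Q : Cube n) (s : Signature n) : (Q.child s).side = Q.side / 2 := by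
  simp only [Cube.side, Cube.child]
  rw [zpow_sub_one₀ (by norm_num)]; ring

theorem vol_child (Q : Cube n) (s : Signature n) : vol (Q.child s) = vol Q / 2 ^ n := by
  rw [vol_eq, vol_eq, Q.side_child, div_pow]

theorem Cube.child_subset (Q : Cube n) (s : Signature n) : (Q.child s).toSet ⊆ Q.toSet := by
  intro x hx i
  have h := hx i
  rw [Q.side_child] at h
  have := Q.side_pos
  simp only [Cube.child, Set.mem_Ico] at h ⊢
  split_ifs at h <;> constructor <;> linarith

theorem Cube.iUnion_child (Q : Cube n) : ⋃ s, (Q.child s).toSet = Q.toSet := by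
  refine subset_antisymm (Set.iUnion_subset Q.child_subset) fun x hx => ?_
  refine Set.mem_iUnion.2 ⟨fun i => if Q.corner i + Q.side / 2 ≤ x i then 1 else 0, fun i => ?_⟩
  rw [Q.side_child]
  have := hx i
  simp only [Cube.child, Set.mem_Ico] at this ⊢
  split_ifs <;> (simp_all; try linarith)

theorem Cube.pairwise_disjoint_child (Q : Cube n) :
    Pairwise (Function.onFun Disjoint fun s => (Q.child s).toSet) := by
  intro s t hst
  refine Set.disjoint_left.2 fun x hx hy => hst ?_
  ext1 i
  have h1 := hx i
  have h2 := hy i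
  rw [Q.side_child] at h1 h2
  simp only [Cube.child, Set.mem_Ico] at h1 h2
  have : s i = 0 ∨ s i = 1 := by omega
  have : t i = 0 ∨ t i = 1 := by omega
  rcases ‹s i = 0 ∨ s i = 1› with h | h <;> rcases ‹t i = 0 ∨ t i = 1› with h' | h' <;>
    simp [h, h'] at h1 h2 ⊢ <;> linarith

theorem Cube.corner_le_of_subset {P Q : Cube n} (h : P.toSet ⊆ Q.toSet) (i : Fin n) :
    Q.corner i ≤ P.corner i := (h P.corner_mem i).1

/-- The axioms of a grid do not mention children. The grid cube one scale down that contains the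
corner of the child lies inside `Q`, and the partition property forces its corner to be the right
one. -/
theorem DyadicGrid.child_mem (hn : n ≠ 0) (D : DyadicGrid n) {Q : Cube n} (hQ : Q ∈ D.cubes)
    (s : Signature n) : Q.child s ∈ D.cubes := by
  have hside : ∀ P : Cube n, P.scale = Q.scale - 1 → P.side = Q.side / 2 := by
    intro P hP
    simp only [Cube.side, hP]
    rw [zpow_sub_one₀ (by norm_num)]; ring
  have key : ∀ y ∈ Q.toSet, ∃ P ∈ D.cubes, P.scale = Q.scale - 1 ∧ y ∈ P.toSet ∧
      P.toSet ⊆ Q.toSet := by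
    intro y hy
    obtain ⟨P, ⟨hP, hs, hyP⟩, -⟩ := D.partition (Q.scale - 1) y
    exact ⟨P, hP, hs, hyP, D.subset_of_scale_le hn hP hQ (by omega) hyP hy⟩
  obtain ⟨P, hP, hPs, hvP, hPQ⟩ := key _ (Q.child_subset s (Q.child s).corner_mem)
  suffices h : P.corner = (Q.child s).corner by
    have : P = Q.child s := by
      cases P; simp_all [Cube.child]
    exact this ▸ hP
  have hQp := Q.side_pos
  ext1 i
  have h1 := hvP i
  have h2 := Cube.corner_le_of_subset hPQ i
  rw [hside P hPs] at h1
  by_cases hsi : s i = 1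
  · by_contra hne
    have hlt : P.corner i < (Q.child s).corner i := lt_of_le_of_ne h1.1 hne
    simp only [Cube.child, hsi, if_true] at hlt h1
    -- If `P` started strictly below the midpoint of `Q` in direction `i`, the grid cube `R` at the
    -- lower face of `Q` over the same position would contain the corner of `P`. Then `R = P`, which
    -- is too low to contain the corner of the child.
    have hy : Function.update P.corner i (Q.corner i) ∈ Q.toSet := by
      intro j
      rcases eq_or_ne j i with rfl | hj
      · simp [hQp]
      · simpa [hj] using hPQ P.corner_mem j
    obtain ⟨R, hR, hRs, hyR, hRQ⟩ := key _ hy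
    have h3 := Cube.corner_le_of_subset hRQ i
    have h4 := hyR i
    simp only [Function.update_self] at h4
    have h5 : R.corner i = Q.corner i := le_antisymm h4.1 h3
    have hPR : P.corner ∈ R.toSet := by
      intro j
      rcases eq_or_ne j i with rfl | hj
      · rw [hside R hRs, h5]
        exact ⟨h2, hlt⟩
      · simpa [hj] using hyR j
    have := D.eq_of_scale_eq hP hR (hPs.trans hRs.symm) P.corner_mem hPR
    rw [← this] at h5
    rw [h5] at h1
    exact lt_irrefl _ h1.2
  · refine le_antisymm h1.1 ?_
    simpa [Cube.child, hsi] using h2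

theorem DyadicGrid.exists_subset_child (hn : n ≠ 0) (D : DyadicGrid n) {P Q : Cube n}
    (hP : P ∈ D.cubes) (hQ : Q ∈ D.cubes) (h : P.toSet ⊆ Q.toSet) (hne : P ≠ Q) :
    ∃ s, P.toSet ⊆ (Q.child s).toSet := by
  have h1 := D.scale_lt_of_ne hn hP hQ h hne
  have h2 : P.corner ∈ ⋃ s, (Q.child s).toSet := Q.iUnion_child ▸ h P.corner_mem
  obtain ⟨s, hs⟩ := Set.mem_iUnion.1 h2
  exact ⟨s, D.subset_of_scale_le hn hP (D.child_mem hn hQ s)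
    (by simp only [Cube.child]; omega) P.corner_mem hs⟩

/-! ### Averages over a cube and its children. -/

theorem Cube.setIntegral_eq_sum_child {f : (Fin n → ℝ) → ℝ} {Q : Cube n}
    (hf : IntegrableOn f Q.toSet) :
    ∫ x in Q.toSet, f x = ∑ s, ∫ x in (Q.child s).toSet, f x := by
  rw [← Q.iUnion_child, integral_iUnion_fintype (fun s => (Q.child s).measurableSet)
    Q.pairwise_disjoint_child fun s => hf.mono_set (Q.child_subset s)]

theorem setIntegral_eq_vol_mul_avg (f : (Fin n → ℝ) → ℝ) (Q : Cube n) :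
    ∫ x in Q.toSet, f x = vol Q * avg f Q := by
  rw [avg, setAverage_eq, smul_eq_mul]
  exact (mul_inv_cancel_left₀ (vol_pos Q).ne' _).symm

theorem avg_eq (f : (Fin n → ℝ) → ℝ) (Q : Cube n) :
    avg f Q = (vol Q)⁻¹ * ∫ x in Q.toSet, f x := by
  rw [setIntegral_eq_vol_mul_avg, inv_mul_cancel_left₀ (vol_pos Q).ne']

theorem avg_nonneg {f : (Fin n → ℝ) → ℝ} (hf : ∀ x, 0 ≤ f x) (Q : Cube n) : 0 ≤ avg f Q := by
  rw [avg_eq]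
  exact mul_nonneg (inv_nonneg.2 (vol_pos Q).le) (integral_nonneg hf)

theorem abs_avg_le (f : (Fin n → ℝ) → ℝ) (Q : Cube n) : |avg f Q| ≤ avg (fun x => |f x|) Q := by
  rw [avg_eq, avg_eq, abs_mul, abs_of_pos (inv_pos.2 (vol_pos Q))]
  exact mul_le_mul_of_nonneg_left (abs_integral_le_integral_abs) (inv_nonneg.2 (vol_pos Q).le)

theorem avg_eq_sum_child {f : (Fin n → ℝ) → ℝ} {Q : Cube n} (hf : IntegrableOn f Q.toSet) :
    avg f Q = (2 ^ n)⁻¹ * ∑ s, avg f (Q.child s) := by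
  rw [avg_eq, Q.setIntegral_eq_sum_child hf]
  simp_rw [setIntegral_eq_vol_mul_avg, vol_child, ← Finset.mul_sum]
  have := (vol_pos Q).ne'
  field_simp

/-- This controls the overshoot at a stopping cube and is the source of the factor `2 ^ n` in the
energy estimate. -/
theorem avg_child_le {f : (Fin n → ℝ) → ℝ} (hf0 : ∀ x, 0 ≤ f x) {Q : Cube n}
    (hf : IntegrableOn f Q.toSet) (s : Signature n) : avg f (Q.child s) ≤ 2 ^ n * avg f Q := by
  rw [avg_eq_sum_child hf, mul_inv_cancel_left₀ (by positivity)]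
  exact Finset.single_le_sum (f := fun s => avg f (Q.child s)) (fun s _ => avg_nonneg hf0 _)
    (Finset.mem_univ s)

/-! ### Haar coefficients -/

/-- The value of a one-dimensional Haar function on the half of the interval given by `s`. -/
def haarValue (e s : Fin 2) (l : ℝ) : ℝ :=
  (Real.sqrt l)⁻¹ * if e = 0 then (if s = 1 then 1 else -1) else 1

theorem haar_of_mem_child {Q : Cube n} (e s : Signature n) {x : Fin n → ℝ}
    (hx : x ∈ (Q.child s).toSet) : haar Q e x = ∏ i, haarValue (e i) (s i) Q.side := by
  refine Finset.prod_congr rfl fun i _ => ?_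
  have h := hx i
  have hp := Q.side_pos
  rw [Q.side_child] at h
  simp only [Cube.child, Set.mem_Ico] at h
  simp only [haarInterval, haarValue, Set.indicator_apply, Set.mem_Ico]
  have h3 : Q.corner i ≤ x i ∧ x i < Q.corner i + Q.side := by
    split_ifs at h <;> constructor <;> linarith
  have h1 : (Q.corner i + Q.side / 2 ≤ x i ∧ x i < Q.corner i + Q.side) ↔ s i = 1 := by
    split_ifs at h with hs <;> simp only [hs, iff_true, iff_false, not_and, not_lt] <;>
      first | (constructor <;> linarith) | (intro; linarith)
  have h2 : (Q.corner i ≤ x i ∧ x i < Q.corner i + Q.side / 2) ↔ ¬ s i = 1 := by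
    split_ifs at h with hs <;> simp only [hs, iff_true, iff_false, not_and, not_lt,
      not_true_eq_false, not_false_eq_true] <;>
      first | (constructor <;> linarith) | (intro; linarith)
  simp only [h3, and_self, if_true]
  split_ifs <;> simp_all

theorem sqrt_vol (Q : Cube n) : Real.sqrt (vol Q) = Real.sqrt Q.side ^ n := by
  rw [vol_eq, Real.sqrt_eq_iff_mul_self_eq (by have := Q.side_pos; positivity) (by positivity),
    ← mul_pow, Real.mul_self_sqrt Q.side_pos.le]

theorem abs_prod_haarValue (Q : Cube n) (e s : Signature n) :
    |∏ i, haarValue (e i) (s i) Q.side| = (Real.sqrt (vol Q))⁻¹ := by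
  have : ∀ i, |haarValue (e i) (s i) Q.side| = (Real.sqrt Q.side)⁻¹ := by
    intro i
    simp only [haarValue, abs_mul, abs_of_nonneg (inv_nonneg.2 (Real.sqrt_nonneg Q.side))]
    split_ifs <;> simp
  rw [Finset.abs_prod, Finset.prod_congr rfl fun i _ => this i, sqrt_vol]
  simp

/-- The sum factors over the coordinates, and the factor of a coordinate with `e i = 0` is `1 - 1`,
up to scaling. -/
theorem sum_prod_haarValue (Q : Cube n) {e : Signature n} (he : e.Cancellative) :
    ∑ s : Signature n, ∏ i, haarValue (e i) (s i) Q.side = 0 := by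
  rw [← Fintype.piFinset_univ,
    ← Finset.prod_univ_sum (fun _ => Finset.univ) fun i t => haarValue (e i) t Q.side]
  obtain ⟨i, hi⟩ : ∃ i, e i ≠ 1 := by
    by_contra! h
    exact he (funext h)
  refine Finset.prod_eq_zero (Finset.mem_univ i) ?_
  have : e i = 0 := by omega
  simp [haarValue, this, Fin.sum_univ_two]

theorem haar_of_notMem {Q : Cube n} (e : Signature n) {x : Fin n → ℝ} (hx : x ∉ Q.toSet) :
    haar Q e x = 0 := by
  simp only [Cube.toSet, Set.mem_ofPred_eq, not_forall] at hx
  obtain ⟨i, hi⟩ := hx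
  refine Finset.prod_eq_zero (Finset.mem_univ i) ?_
  have hp := Q.side_pos
  have h1 : x i ∉ Set.Ico (Q.corner i + Q.side / 2) (Q.corner i + Q.side) := fun h =>
    hi ⟨by linarith [h.1], h.2⟩
  have h2 : x i ∉ Set.Ico (Q.corner i) (Q.corner i + Q.side / 2) := fun h =>
    hi ⟨h.1, by linarith [h.2]⟩
  simp [haarInterval, hi, h1, h2]

theorem abs_haar (Q : Cube n) (e : Signature n) (x : Fin n → ℝ) :
    |haar Q e x| = (Real.sqrt (vol Q))⁻¹ * Q.toSet.indicator (fun _ => (1 : ℝ)) x := by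
  by_cases hx : x ∈ Q.toSet
  · obtain ⟨s, hs⟩ := Set.mem_iUnion.1 (Q.iUnion_child ▸ hx : x ∈ ⋃ s, (Q.child s).toSet)
    rw [haar_of_mem_child e s hs, abs_prod_haarValue]
    simp [hx]
  · simp [haar_of_notMem e hx, hx]

theorem measurable_haarInterval (e : Fin 2) (a l : ℝ) : Measurable (haarInterval e a l) := by
  unfold haarInterval
  split_ifs
  · exact ((measurable_const.indicator measurableSet_Ico).sub
      (measurable_const.indicator measurableSet_Ico)).const_mul _
  · exact (measurable_const.indicator measurableSet_Ico).const_mul _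

theorem measurable_haar (Q : Cube n) (e : Signature n) : Measurable (haar Q e) := by
  unfold haar
  exact Finset.measurable_prod _ fun i _ =>
    (measurable_haarInterval _ _ _).comp (measurable_pi_apply i)

theorem integrableOn_mul_haar {f : (Fin n → ℝ) → ℝ} {Q : Cube n} (hf : IntegrableOn f Q.toSet)
    (e : Signature n) : IntegrableOn (fun x => f x * haar Q e x) Q.toSet := by
  refine Integrable.mul_bdd (c := (Real.sqrt (vol Q))⁻¹) hf
    (measurable_haar Q e).aestronglyMeasurable (ae_of_all _ fun x => ?_)
  rw [Real.norm_eq_abs, abs_haar]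
  refine mul_le_of_le_one_right (by positivity) ?_
  exact Set.indicator_le' (fun _ _ => le_rfl) (fun _ _ => zero_le_one) x

theorem integrable_mul_haar {f : (Fin n → ℝ) → ℝ} {Q : Cube n} (hf : IntegrableOn f Q.toSet)
    (e : Signature n) : Integrable (fun x => f x * haar Q e x) := by
  rw [← integrableOn_iff_integrable_of_support_subset (s := Q.toSet)]
  · exact integrableOn_mul_haar hf e
  · intro x hx
    by_contra h
    exact hx (by simp [haar_of_notMem e h])

theorem pairing_eq_setIntegral (f : (Fin n → ℝ) → ℝ) (Q : Cube n) (e : Signature n) :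
    pairing f (haar Q e) = ∫ x in Q.toSet, f x * haar Q e x := by
  rw [pairing, setIntegral_eq_integral_of_forall_compl_eq_zero]
  intro x hx
  simp [haar_of_notMem e hx]

/-- The quadratic mean of the martingale difference of `f` on `Q`. -/
def osc (f : (Fin n → ℝ) → ℝ) (Q : Cube n) : ℝ :=
  Real.sqrt ((2 ^ n)⁻¹ * ∑ s, (avg f (Q.child s) - avg f Q) ^ 2)

theorem osc_nonneg (f : (Fin n → ℝ) → ℝ) (Q : Cube n) : 0 ≤ osc f Q := Real.sqrt_nonneg _

theorem osc_sq (f : (Fin n → ℝ) → ℝ) (Q : Cube n) :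
    osc f Q ^ 2 = (2 ^ n)⁻¹ * ∑ s, (avg f (Q.child s) - avg f Q) ^ 2 :=
  Real.sq_sqrt (mul_nonneg (by positivity) (Finset.sum_nonneg fun _ _ => sq_nonneg _))

/-- A Haar function is constant on children, with modulus `|Q|^(-1/2)`, and has mean zero. Hence
only the differences `⟨f⟩_child - ⟨f⟩_Q` contribute, and their mean modulus is at most their
quadratic mean. -/
theorem abs_pairing_haar_le {f : (Fin n → ℝ) → ℝ} {Q : Cube n} (hf : IntegrableOn f Q.toSet)
    {e : Signature n} (he : e.Cancellative) :
    |pairing f (haar Q e)| ≤ Real.sqrt (vol Q) * osc f Q := by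
  have hv := vol_pos Q
  have h1 : pairing f (haar Q e) = ∑ s, (∏ i, haarValue (e i) (s i) Q.side) *
      (vol Q / 2 ^ n * (avg f (Q.child s) - avg f Q)) := by
    rw [pairing_eq_setIntegral, Cube.setIntegral_eq_sum_child (integrableOn_mul_haar hf e)]
    have h2 : ∑ s : Signature n, (∏ i, haarValue (e i) (s i) Q.side) *
        (vol Q / 2 ^ n * avg f Q) = 0 := by
      rw [← Finset.sum_mul, sum_prod_haarValue Q he, zero_mul]
    rw [← sub_zero (∑ s, ∫ x in (Q.child s).toSet, f x * haar Q e x), ← h2,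
      ← Finset.sum_sub_distrib]
    refine Finset.sum_congr rfl fun s _ => ?_
    rw [setIntegral_congr_fun (Q.child s).measurableSet
      (g := fun x => (∏ i, haarValue (e i) (s i) Q.side) * f x)
      (fun x hx => by simp only [haar_of_mem_child e s hx]; ring), integral_const_mul,
      setIntegral_eq_vol_mul_avg, vol_child]
    ring
  have hcs : ((2 ^ n)⁻¹ * ∑ s : Signature n, |avg f (Q.child s) - avg f Q|) ≤ osc f Q := by
    refine Real.le_sqrt_of_sq_le ?_
    have h3 := sq_sum_le_card_mul_sum_sq (s := (Finset.univ : Finset (Signature n)))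
      (f := fun s => |avg f (Q.child s) - avg f Q|)
    simp only [sq_abs, Finset.card_univ, Fintype.card_pi, Fintype.card_fin, Finset.prod_const] at h3
    push_cast at h3
    rw [mul_pow]
    calc _ ≤ ((2 ^ n : ℝ)⁻¹) ^ 2 * (2 ^ n * ∑ s, (avg f (Q.child s) - avg f Q) ^ 2) := by
          gcongr
      _ = _ := by field_simp
  calc |pairing f (haar Q e)|
      ≤ ∑ s, |(∏ i, haarValue (e i) (s i) Q.side) *
          (vol Q / 2 ^ n * (avg f (Q.child s) - avg f Q))| := by
        rw [h1]; exact Finset.abs_sum_le_sum_abs _ _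
    _ = Real.sqrt (vol Q) * ((2 ^ n)⁻¹ * ∑ s : Signature n, |avg f (Q.child s) - avg f Q|) := by
        simp_rw [abs_mul, abs_prod_haarValue, abs_of_pos (by positivity : 0 < vol Q / 2 ^ n)]
        have hs : (Real.sqrt (vol Q))⁻¹ * vol Q = Real.sqrt (vol Q) := by
          rw [inv_mul_eq_div, Real.div_sqrt]
        rw [Finset.mul_sum, Finset.mul_sum]
        refine Finset.sum_congr rfl fun s _ => ?_
        calc _ = ((Real.sqrt (vol Q))⁻¹ * vol Q) * ((2 ^ n)⁻¹ * |avg f (Q.child s) - avg f Q|) := by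
              ring
          _ = _ := by rw [hs]
    _ ≤ _ := by gcongr

theorem avg_sub_const {f : (Fin n → ℝ) → ℝ} {Q : Cube n} (hf : IntegrableOn f Q.toSet) (c : ℝ) :
    avg (fun x => f x - c) Q = avg f Q - c := by
  rw [avg_eq, avg_eq, integral_sub hf (integrableOn_const Q.volume_ne_top),
    setIntegral_const, smul_eq_mul]
  change (vol Q)⁻¹ * (_ - vol Q * c) = _
  rw [mul_sub, inv_mul_cancel_left₀ (vol_pos Q).ne']

/-- This lets `b` be replaced by `b - ⟨b⟩_P`, so that the square function estimate produces the mean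
oscillation of `b` rather than the average of `|b|`. -/
theorem osc_sub_const {f : (Fin n → ℝ) → ℝ} {Q : Cube n} (hf : IntegrableOn f Q.toSet) (c : ℝ) :
    osc (fun x => f x - c) Q = osc f Q := by
  simp only [osc, avg_sub_const hf, avg_sub_const (hf.mono_set (Q.child_subset _))]
  simp

/-- Pythagoras for one martingale difference. Over successive generations the right side telescopes,
which drives the induction in `sum_vol_mul_osc_sq_le`. -/
theorem vol_mul_osc_sq {f : (Fin n → ℝ) → ℝ} {Q : Cube n} (hf : IntegrableOn f Q.toSet) :
    vol Q * osc f Q ^ 2 =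
      (∑ s, vol (Q.child s) * avg f (Q.child s) ^ 2) - vol Q * avg f Q ^ 2 := by
  have h := avg_eq_sum_child hf
  have h1 : ∑ s, avg f (Q.child s) = 2 ^ n * avg f Q := by rw [h]; field_simp
  rw [osc_sq]
  simp_rw [vol_child, sub_sq, Finset.sum_add_distrib, Finset.sum_sub_distrib, mul_assoc,
    ← Finset.mul_sum, ← Finset.sum_mul]
  rw [h1]
  simp only [Finset.sum_const, Finset.card_univ, Fintype.card_pi, Fintype.card_fin,
    Finset.prod_const, nsmul_eq_mul]
  push_cast
  field_simp
  ring

end Geometry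

/-! ### The weak type inequality for the dyadic square function -/

section WeakType

variable {n : ℕ}

open Classical in
theorem sum_insert_le_of_nonneg {ι : Type*} {g : ι → ℝ} (hg : ∀ i, 0 ≤ g i) {a : ι} {A : Finset ι} :
    ∑ i ∈ insert a A, g i ≤ g a + ∑ i ∈ A, g i := by
  by_cases h : a ∈ A
  · rw [Finset.insert_eq_of_mem h]; linarith [hg a]
  · rw [Finset.sum_insert h]

open Classical in
theorem sum_biUnion_le_of_nonneg {ι κ : Type*} [Fintype κ] {g : ι → ℝ} (hg : ∀ i, 0 ≤ g i)
    {A : κ → Finset ι} : ∑ i ∈ Finset.univ.biUnion A, g i ≤ ∑ t, ∑ i ∈ A t, g i := by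
  have h : ∀ t, ∑ i ∈ A t, g i = ∑ i ∈ Finset.univ.biUnion A, if i ∈ A t then g i else 0 := by
    intro t
    rw [← Finset.sum_filter, Finset.filter_mem_eq_inter, Finset.inter_eq_right.2
      (Finset.subset_biUnion_of_mem A (Finset.mem_univ t))]
  simp_rw [h]
  rw [Finset.sum_comm]
  refine Finset.sum_le_sum fun i hi => ?_
  obtain ⟨t, -, ht⟩ := Finset.mem_biUnion.1 hi
  calc g i = if i ∈ A t then g i else 0 := by rw [if_pos ht]
    _ ≤ _ := Finset.single_le_sum (f := fun t => if i ∈ A t then g i else 0)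
      (fun t _ => by split_ifs <;> simp [hg]) (Finset.mem_univ t)

/-- One of the two averages is bounded by `s`, the other is integrated. This handles the cubes at
which the telescoping ends. -/
theorem vol_mul_avg_sq_le {f : (Fin n → ℝ) → ℝ} {R : Cube n} {s : ℝ}
    (h : avg (fun x => |f x|) R ≤ s) :
    vol R * avg f R ^ 2 ≤ s * ∫ x in R.toSet, |f x| := by
  have h0 := avg_nonneg (fun x => abs_nonneg (f x)) R
  have h1 : avg f R ^ 2 ≤ avg (fun x => |f x|) R ^ 2 :=
    sq_le_sq' (abs_le.1 (abs_avg_le f R)).1 (abs_le.1 (abs_avg_le f R)).2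
  have hv := vol_pos R
  rw [setIntegral_eq_vol_mul_avg]
  calc vol R * avg f R ^ 2 ≤ vol R * (avg (fun x => |f x|) R * avg (fun x => |f x|) R) := by
        rw [← sq]; gcongr
    _ ≤ vol R * (s * avg (fun x => |f x|) R) := by gcongr
    _ = _ := by ring

open Classical in
/-- The `L²` bound for the square function of a dyadic martingale stopped when the averages of
`|f|` exceed `s`. -/
theorem sum_vol_mul_osc_sq_le (hn : n ≠ 0) (D : DyadicGrid n) {f : (Fin n → ℝ) → ℝ}
    (hf : ∀ Q ∈ D.cubes, IntegrableOn f Q.toSet) {s : ℝ} (N : ℕ) :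
    ∀ R ∈ D.cubes, avg (fun x => |f x|) R ≤ s → ∀ G : Finset (Cube n),
      (∀ Q ∈ G, Q ∈ D.cubes ∧ Q.toSet ⊆ R.toSet ∧ R.scale < Q.scale + N ∧
        ∀ R' ∈ D.cubes, Q.toSet ⊆ R'.toSet → R'.toSet ⊆ R.toSet → avg (fun x => |f x|) R' ≤ s) →
      ∑ Q ∈ G, vol Q * osc f Q ^ 2 + vol R * avg f R ^ 2 ≤
        2 ^ n * s * ∫ x in R.toSet, |f x| := by
  -- The induction is on the number `N` of generations below `R` that `G` may occupy. The term `vol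
  -- R * avg f R ^ 2` is kept on the left so that it can telescope.
  have hone : (1 : ℝ) ≤ 2 ^ n := one_le_pow₀ (by norm_num)
  induction N with
  | zero =>
    intro R hR hs G hG
    have hs0 : 0 ≤ s := (avg_nonneg (fun x => abs_nonneg (f x)) R).trans hs
    have : G = ∅ := by
      refine Finset.eq_empty_of_forall_notMem fun Q hQ => ?_
      obtain ⟨-, h1, h2, -⟩ := hG Q hQ
      have := Cube.scale_le_of_subset hn h1
      simp only [Nat.cast_zero, add_zero] at h2
      omega
    rw [this, Finset.sum_empty, zero_add]
    refine (vol_mul_avg_sq_le hs).trans ?_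
    refine mul_le_mul_of_nonneg_right ?_ (integral_nonneg fun x => abs_nonneg _)
    nlinarith
  | succ N ih =>
    intro R hR hs G hG
    have hs0 : 0 ≤ s := (avg_nonneg (fun x => abs_nonneg (f x)) R).trans hs
    set Gs : Signature n → Finset (Cube n) := fun t => {Q ∈ G | Q.toSet ⊆ (R.child t).toSet}
    have hsub : G ⊆ insert R (Finset.univ.biUnion Gs) := by
      intro Q hQ
      obtain ⟨hQD, hQR, -, -⟩ := hG Q hQ
      rcases eq_or_ne Q R with rfl | hne
      · exact Finset.mem_insert_self _ _
      · obtain ⟨t, ht⟩ := D.exists_subset_child hn hQD hR hQR hne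
        exact Finset.mem_insert_of_mem (Finset.mem_biUnion.2 ⟨t, Finset.mem_univ _,
          Finset.mem_filter.2 ⟨hQ, ht⟩⟩)
    have hnn : ∀ Q : Cube n, 0 ≤ vol Q * osc f Q ^ 2 := fun Q =>
      mul_nonneg (vol_pos Q).le (sq_nonneg _)
    have h1 : ∑ Q ∈ G, vol Q * osc f Q ^ 2 ≤
        vol R * osc f R ^ 2 + ∑ t, ∑ Q ∈ Gs t, vol Q * osc f Q ^ 2 := by
      refine (Finset.sum_le_sum_of_subset_of_nonneg hsub fun Q _ _ => hnn Q).trans ?_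
      refine (sum_insert_le_of_nonneg hnn).trans ?_
      gcongr
      exact sum_biUnion_le_of_nonneg hnn
    have h2 : ∀ t, ∑ Q ∈ Gs t, vol Q * osc f Q ^ 2 + vol (R.child t) * avg f (R.child t) ^ 2 ≤
        2 ^ n * s * ∫ x in (R.child t).toSet, |f x| := by
      intro t
      by_cases ht : avg (fun x => |f x|) (R.child t) ≤ s
      · refine ih _ (D.child_mem hn hR t) ht _ fun Q hQ => ?_
        obtain ⟨hQ, hQt⟩ := Finset.mem_filter.1 hQ
        obtain ⟨hQD, hQR, hsc, hst⟩ := hG Q hQ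
        refine ⟨hQD, hQt, ?_, fun R' hR' h h' => hst R' hR' h (h'.trans (R.child_subset t))⟩
        simp only [Cube.child]
        push_cast at hsc
        omega
      -- A child whose average exceeds `s` is a stopping cube: no cube of `G` lies inside it. Its
      -- average is still at most `2 ^ n * s` because that of its parent is at most `s`.
      · have : Gs t = ∅ := by
          refine Finset.eq_empty_of_forall_notMem fun Q hQ => ht ?_
          obtain ⟨hQ, hQt⟩ := Finset.mem_filter.1 hQ
          exact (hG Q hQ).2.2.2 _ (D.child_mem hn hR t) hQt (R.child_subset t)
        rw [this, Finset.sum_empty, zero_add]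
        refine vol_mul_avg_sq_le ?_
        refine (avg_child_le (fun x => abs_nonneg (f x)) (hf R hR).abs t).trans ?_
        gcongr
    have h3 := Finset.sum_le_sum fun t (_ : t ∈ Finset.univ) => h2 t
    rw [← Finset.mul_sum, ← Cube.setIntegral_eq_sum_child (hf R hR).abs,
      Finset.sum_add_distrib] at h3
    have h4 := vol_mul_osc_sq (hf R hR)
    linarith
/-- The maximal cubes of a family. -/
def maximalCubes (R : Set (Cube n)) : Set (Cube n) :=
  {Q ∈ R | ∀ P ∈ R, Q.toSet ⊆ P.toSet → P = Q}

/-- The bound `K` on the scales is essential: an ancestor of largest scale is maximal. -/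
theorem DyadicGrid.exists_mem_maximalCubes (hn : n ≠ 0) (D : DyadicGrid n) {R : Set (Cube n)}
    (hR : R ⊆ D.cubes) {K : ℤ} (hK : ∀ Q ∈ R, Q.scale ≤ K) {Q : Cube n} (hQ : Q ∈ R) :
    ∃ P ∈ maximalCubes R, Q.toSet ⊆ P.toSet := by
  obtain ⟨k, ⟨P, hP, hQP, rfl⟩, hk⟩ := Int.exists_greatest_of_bdd
    (P := fun k => ∃ P ∈ R, Q.toSet ⊆ P.toSet ∧ P.scale = k)
    ⟨K, fun k ⟨P, hP, _, h⟩ => h ▸ hK P hP⟩ ⟨_, Q, hQ, subset_rfl, rfl⟩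
  refine ⟨P, ⟨hP, fun P' hP' h => ?_⟩, hQP⟩
  exact (D.eq_of_scale_eq (hR hP) (hR hP') (le_antisymm (Cube.scale_le_of_subset hn h)
    (hk _ ⟨P', hP', hQP.trans h, rfl⟩)) P.corner_mem (h P.corner_mem)).symm

theorem DyadicGrid.pairwiseDisjoint_maximalCubes (hn : n ≠ 0) (D : DyadicGrid n)
    {R : Set (Cube n)} (hR : R ⊆ D.cubes) : (maximalCubes R).PairwiseDisjoint Cube.toSet := by
  intro P hP Q hQ hne
  refine Set.disjoint_left.2 fun x hx hy => hne ?_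
  rcases le_total P.scale Q.scale with h | h
  · exact (hP.2 Q hQ.1 (D.subset_of_scale_le hn (hR hP.1) (hR hQ.1) h hx hy)).symm
  · exact hQ.2 P hP.1 (D.subset_of_scale_le hn (hR hQ.1) (hR hP.1) h hy hx)

theorem DyadicGrid.biUnion_maximalCubes (hn : n ≠ 0) (D : DyadicGrid n) {R : Set (Cube n)}
    (hR : R ⊆ D.cubes) {K : ℤ} (hK : ∀ Q ∈ R, Q.scale ≤ K) :
    ⋃ Q ∈ maximalCubes R, Q.toSet = ⋃ Q ∈ R, Q.toSet := by
  refine subset_antisymm (Set.biUnion_subset_biUnion_left fun Q hQ => hQ.1) ?_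
  refine Set.iUnion₂_subset fun Q hQ => ?_
  obtain ⟨P, hP, hQP⟩ := D.exists_mem_maximalCubes hn hR hK hQ
  exact hQP.trans (Set.subset_biUnion_of_mem (u := Cube.toSet) hP)

/-- The dyadic maximal inequality. -/
theorem DyadicGrid.mul_volume_biUnion_le (hn : n ≠ 0) (D : DyadicGrid n) {R : Set (Cube n)}
    (hR : R ⊆ D.cubes) {K : ℤ} (hK : ∀ Q ∈ R, Q.scale ≤ K) {c : ℝ≥0∞}
    {F : (Fin n → ℝ) → ℝ≥0∞} (h : ∀ Q ∈ R, c * volume Q.toSet ≤ ∫⁻ x in Q.toSet, F x) :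
    c * volume (⋃ Q ∈ R, Q.toSet) ≤ ∫⁻ x in ⋃ Q ∈ R, Q.toSet, F x := by
  have hc : (maximalCubes R).Countable := D.countable.mono fun Q hQ => hR hQ.1
  have hd := D.pairwiseDisjoint_maximalCubes hn hR
  rw [← D.biUnion_maximalCubes hn hR hK, measure_biUnion hc hd fun Q _ => Q.measurableSet,
    lintegral_biUnion hc (fun Q _ => Q.measurableSet) hd, ← ENNReal.tsum_mul_left]
  exact ENNReal.tsum_le_tsum fun Q => h Q.1 Q.2.1

open Classical in
/-- The weak type inequality for the dyadic square function, localized to the cube `P`. -/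
theorem measureReal_squareFunction_le (hn : n ≠ 0) (D : DyadicGrid n) {f : (Fin n → ℝ) → ℝ}
    (hf : ∀ Q ∈ D.cubes, IntegrableOn f Q.toSet) {P : Cube n} (hP : P ∈ D.cubes)
    {G : Finset (Cube n)} (hG : ∀ Q ∈ G, Q ∈ D.cubes ∧ Q.toSet ⊆ P.toSet) {A : ℝ} (hA : 1 ≤ A) :
    volume.real {x ∈ P.toSet | 2 ^ n * A ^ 2 * avg (fun x => |f x|) P ^ 2 <
      ∑ Q ∈ G, osc f Q ^ 2 * Q.toSet.indicator (fun _ => 1) x} ≤ 2 / A * vol P := by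
  have hA0 : 0 < A := by linarith
  have hv := vol_pos P
  set m := avg (fun x => |f x|) P with hm
  have hm0 : 0 ≤ m := avg_nonneg (fun x => abs_nonneg (f x)) P
  have hmA : m ≤ A * m := le_mul_of_one_le_left hm0 hA
  obtain ⟨k, hk⟩ : ∃ k : ℕ, ∀ Q ∈ G, P.scale < Q.scale + k := by
    obtain ⟨k, hk⟩ := (G.finite_toSet.image fun Q => (P.scale - Q.scale).toNat).bddAbove
    refine ⟨k + 1, fun Q hQ => ?_⟩
    have := hk (Set.mem_image_of_mem _ (Finset.mem_coe.2 hQ))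
    push_cast
    omega
  -- Calderón–Zygmund splitting at height `A * m`. The maximal inequality gives the union `U` of
  -- these cubes measure at most `vol P / A`; off `U` only the cubes of `G'` matter, and they
  -- satisfy the `L²` bound.
  set R : Set (Cube n) := {Q ∈ D.cubes | Q.toSet ⊆ P.toSet ∧ A * m < avg (fun x => |f x|) Q}
  set G' := {Q ∈ G | ∀ R' ∈ R, ¬ Q.toSet ⊆ R'.toSet} with hG'
  have hen := sum_vol_mul_osc_sq_le hn D hf k P hP hmA G' fun Q hQ => by
    obtain ⟨hQ, h⟩ := Finset.mem_filter.1 hQ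
    refine ⟨(hG Q hQ).1, (hG Q hQ).2, hk Q hQ, fun R' hR' h1 h2 => ?_⟩
    by_contra h3
    exact h R' ⟨hR', h2, not_le.1 h3⟩ h1
  rw [setIntegral_eq_vol_mul_avg, ← hm] at hen
  have hen' : ∑ Q ∈ G', vol Q * osc f Q ^ 2 ≤ 2 ^ n * A * m ^ 2 * vol P := by
    have : 0 ≤ vol P * avg f P ^ 2 := by positivity
    linarith
  set U := ⋃ Q ∈ R, Q.toSet
  have hUP : U ⊆ P.toSet := Set.iUnion₂_subset fun Q hQ => hQ.2.1
  have hUtop : volume U ≠ ∞ := measure_ne_top_of_subset hUP P.volume_ne_top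
  have hU : A * m * volume.real U ≤ m * vol P := by
    have h1 : ENNReal.ofReal (A * m) * volume U ≤ ∫⁻ x in U, ENNReal.ofReal |f x| := by
      refine D.mul_volume_biUnion_le hn (fun Q hQ => hQ.1)
        (fun Q hQ => Cube.scale_le_of_subset hn hQ.2.1) fun Q hQ => ?_
      rw [← ofReal_integral_eq_lintegral_ofReal (hf Q hQ.1).abs (ae_of_all _ fun x => abs_nonneg _),
        setIntegral_eq_vol_mul_avg, Q.volume_eq, ← ENNReal.ofReal_mul (by positivity)]
      refine ENNReal.ofReal_le_ofReal ?_
      rw [mul_comm]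
      exact mul_le_mul_of_nonneg_left hQ.2.2.le (vol_pos Q).le
    have h2 := h1.trans (lintegral_mono_set hUP)
    rw [← ofReal_integral_eq_lintegral_ofReal (hf P hP).abs (ae_of_all _ fun x => abs_nonneg _),
      setIntegral_eq_vol_mul_avg, ← hm, ← ofReal_measureReal hUtop,
      ← ENNReal.ofReal_mul (by positivity), ENNReal.ofReal_le_ofReal_iff (by positivity)] at h2
    linarith
  set B := {x | 2 ^ n * A ^ 2 * m ^ 2 ≤ ∑ Q ∈ G', osc f Q ^ 2 * Q.toSet.indicator (fun _ => 1) x}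
  have hint : ∀ Q : Cube n, Integrable (fun x => osc f Q ^ 2 * Q.toSet.indicator (fun _ => 1) x) :=
    fun Q => ((integrable_indicator_iff Q.measurableSet).2
      (integrableOn_const Q.volume_ne_top)).const_mul _
  -- Chebyshev's inequality at the level `2 ^ n * A ^ 2 * m ^ 2`, against the energy `2 ^ n * A * m
  -- ^ 2 * vol P`, gains the factor `1 / A`.
  have hB : 2 ^ n * A ^ 2 * m ^ 2 * volume.real B ≤ 2 ^ n * A * m ^ 2 * vol P := by
    refine (mul_meas_ge_le_integral_of_nonneg (ae_of_all _ fun x => Finset.sum_nonneg fun Q _ =>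
      mul_nonneg (sq_nonneg _) (Set.indicator_nonneg (fun _ _ => zero_le_one) x))
      (integrable_finsetSum _ fun Q _ => hint Q) _).trans ?_
    rw [integral_finsetSum _ fun Q _ => hint Q]
    refine le_trans (le_of_eq ?_) hen'
    refine Finset.sum_congr rfl fun Q _ => ?_
    rw [integral_const_mul, integral_indicator_const _ Q.measurableSet, smul_eq_mul, mul_one,
      mul_comm]
    rfl
  -- For `m = 0` one cannot divide by the level. In that case the energy estimate with `s = 0` makes
  -- every oscillation vanish, and the set is empty since the inequality defining it is strict.
  rcases hm0.eq_or_lt with h0 | h0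
  · have hall : ∀ Q ∈ G, osc f Q = 0 := by
      intro Q hQ
      have h1 := sum_vol_mul_osc_sq_le hn D hf (s := 0) k P hP (by linarith) {Q} fun Q' hQ' => by
        obtain rfl := Finset.mem_singleton.1 hQ'
        refine ⟨(hG Q' hQ).1, (hG Q' hQ).2, hk Q' hQ, fun R' hR' _ h2 => ?_⟩
        have h3 : ∫ x in R'.toSet, |f x| ≤ ∫ x in P.toSet, |f x| :=
          setIntegral_mono_set (hf P hP).abs (ae_of_all _ fun x => abs_nonneg _) h2.eventuallyLE
        rw [setIntegral_eq_vol_mul_avg, setIntegral_eq_vol_mul_avg, ← hm, ← h0, mul_zero] at h3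
        exact nonpos_of_mul_nonpos_right h3 (vol_pos R')
      rw [Finset.sum_singleton] at h1
      have h2 := vol_pos Q
      have h3 : vol Q * osc f Q ^ 2 ≤ 0 := by
        have : 0 ≤ vol P * avg f P ^ 2 := by positivity
        linarith
      have h4 : osc f Q ^ 2 ≤ 0 := nonpos_of_mul_nonpos_right h3 h2
      exact pow_eq_zero_iff (two_ne_zero) |>.1 (le_antisymm h4 (sq_nonneg _))
    have : {x ∈ P.toSet | 2 ^ n * A ^ 2 * m ^ 2 <
        ∑ Q ∈ G, osc f Q ^ 2 * Q.toSet.indicator (fun _ => 1) x} = ∅ := by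
      refine Set.eq_empty_of_forall_notMem fun x hx => ?_
      have h1 := hx.2
      rw [Finset.sum_eq_zero fun Q hQ => by rw [hall Q hQ]; ring] at h1
      exact absurd h1 (not_lt.2 (by positivity))
    rw [this]
    simp only [measureReal_empty]
    positivity
  · have hsub : {x ∈ P.toSet | 2 ^ n * A ^ 2 * m ^ 2 <
        ∑ Q ∈ G, osc f Q ^ 2 * Q.toSet.indicator (fun _ => 1) x} ⊆ U ∪ (B ∩ P.toSet) := by
      intro x hx
      by_cases hxU : x ∈ U
      · exact Or.inl hxU
      · refine Or.inr ⟨hx.2.le.trans (le_of_eq ?_), hx.1⟩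
        rw [hG', Finset.sum_filter]
        refine Finset.sum_congr rfl fun Q hQ => ?_
        split_ifs with h
        · rfl
        · push Not at h
          obtain ⟨R', hR', hQR'⟩ := h
          have : x ∉ Q.toSet := fun hxQ => hxU (Set.mem_biUnion hR' (hQR' hxQ))
          simp [this]
    have h1 := measureReal_mono (μ := volume) hsub
      (measure_ne_top_of_subset (Set.union_subset hUP Set.inter_subset_right) P.volume_ne_top)
    have h2 := h1.trans (measureReal_union_le _ _)
    have h3 : volume.real (B ∩ P.toSet) ≤ 1 / A * vol P := by
      have hBtop : volume B ≠ ∞ := by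
        have := (integrable_finsetSum G' fun Q _ => hint Q).measure_ge_lt_top
          (ε := 2 ^ n * A ^ 2 * m ^ 2) (by positivity)
        exact this.ne
      have h4 := measureReal_mono (μ := volume) (Set.inter_subset_left (s := B) (t := P.toSet)) hBtop
      refine h4.trans ?_
      have h5 : 0 < 2 ^ n * A ^ 2 * m ^ 2 := by positivity
      refine le_of_mul_le_mul_left (hB.trans (le_of_eq ?_)) h5
      field_simp
    have h4 : volume.real U ≤ 1 / A * vol P := by
      refine le_of_mul_le_mul_left (hU.trans (le_of_eq ?_)) (by positivity : 0 < A * m)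
      field_simp
    calc _ ≤ _ := h2
      _ ≤ 1 / A * vol P + 1 / A * vol P := add_le_add h4 h3
      _ = _ := by ring

end WeakType

/-! ### Sparse domination -/

section SparseDomination

variable {n : ℕ}

/-- The mean oscillation `⟨|f - ⟨f⟩_Q|⟩_Q`. -/
def meanOsc (f : (Fin n → ℝ) → ℝ) (Q : Cube n) : ℝ := avg (fun x => |f x - avg f Q|) Q

theorem meanOsc_nonneg (f : (Fin n → ℝ) → ℝ) (Q : Cube n) : 0 ≤ meanOsc f Q :=
  avg_nonneg (fun _ => abs_nonneg _) Q

/-- `E` witnesses that the family `S` is `η`-sparse. -/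
def SparseWitness (η : ℝ) (S : Set (Cube n)) (E : Cube n → Set (Fin n → ℝ)) : Prop :=
  (∀ Q ∈ S, MeasurableSet (E Q) ∧ E Q ⊆ Q.toSet ∧
    ENNReal.ofReal η * volume Q.toSet ≤ volume (E Q)) ∧ S.PairwiseDisjoint E

open Classical in
-- Induction on `F`. A cube `P` of largest scale is put into `S`; the cubes inside `P` at which
-- neither square function has become large are absorbed into the single term of `P`, and the rest
-- are treated by induction. The region outside the stopped cubes of `P` serves as `E P`.
theorem exists_sparse_domination (hn : n ≠ 0) (D : DyadicGrid n) {b g : (Fin n → ℝ) → ℝ}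
    (hb : ∀ Q ∈ D.cubes, IntegrableOn b Q.toSet) (hg : ∀ Q ∈ D.cubes, IntegrableOn g Q.toSet)
    {θ : ℝ} (hθ0 : 0 < θ) (hθ1 : θ < 1) (F : Finset (Cube n)) :
    (∀ Q ∈ F, Q ∈ D.cubes) → ∃ (S : Finset (Cube n)) (E : Cube n → Set (Fin n → ℝ)),
      S ⊆ F ∧ SparseWitness (1 - θ) (S : Set (Cube n)) E ∧
      ∀ x, ∑ Q ∈ F, osc b Q * osc g Q * Q.toSet.indicator (fun _ => 1) x ≤
        16 * 2 ^ n / θ ^ 2 * ∑ P ∈ S, meanOsc b P * avg (fun x => |g x|) P *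
          P.toSet.indicator (fun _ => 1) x := by
  induction F using Finset.strongInductionOn with
  | _ F ih =>
  intro hF
  rcases F.eq_empty_or_nonempty with rfl | hne
  · exact ⟨∅, fun _ => ∅, subset_rfl, ⟨by simp, by simp⟩, by simp⟩
  obtain ⟨P, hPF, hPmax⟩ := F.exists_max_image Cube.scale hne
  have hPD := hF P hPF
  -- Each of the two weak type estimates then costs measure `2 / A * vol P = θ / 2 * vol P`,
  -- together at most `θ * vol P`; the final constant is `2 ^ n * A ^ 2`.
  set A : ℝ := 4 / θ with hA
  have hA1 : 1 ≤ A := by rw [hA, le_div_iff₀ hθ0]; linarith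
  set b' : (Fin n → ℝ) → ℝ := fun x => b x - avg b P with hb'
  have hb'i : ∀ Q ∈ D.cubes, IntegrableOn b' Q.toSet := fun Q hQ =>
    (hb Q hQ).sub (integrableOn_const Q.volume_ne_top)
  have hosc : ∀ Q ∈ F, osc b' Q = osc b Q := fun Q hQ => osc_sub_const (hb Q (hF Q hQ)) _
  set F1 := {Q ∈ F | Q.toSet ⊆ P.toSet} with hF1
  set tb := 2 ^ n * A ^ 2 * meanOsc b P ^ 2 with htb
  set tg := 2 ^ n * A ^ 2 * avg (fun x => |g x|) P ^ 2 with htg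
  -- On `Q` the square function is at least the sum over the cubes of `F1` containing `Q`. Testing
  -- that sum makes stopping a property of `Q` rather than of a point.
  set Z := {Q ∈ F1 | tb < ∑ R ∈ F1 with Q.toSet ⊆ R.toSet, osc b R ^ 2 ∨
    tg < ∑ R ∈ F1 with Q.toSet ⊆ R.toSet, osc g R ^ 2} with hZ
  have hF1D : ∀ Q ∈ F1, Q ∈ D.cubes ∧ Q.toSet ⊆ P.toSet := fun Q hQ =>
    ⟨hF Q (Finset.mem_filter.1 hQ).1, (Finset.mem_filter.1 hQ).2⟩
  set U := ⋃ Q ∈ Z, Q.toSet with hU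
  have hUP : U ⊆ P.toSet := Set.iUnion₂_subset fun Q hQ => (hF1D Q (Finset.mem_filter.1 hQ).1).2
  have hUm : MeasurableSet U := Finset.measurableSet_biUnion _ fun Q _ => Q.measurableSet
  have hUvol : volume.real U ≤ θ * vol P := by
    have h1 := measureReal_squareFunction_le hn D hb'i hPD hF1D hA1
    have h2 := measureReal_squareFunction_le hn D hg hPD hF1D hA1
    have hle : ∀ (f : (Fin n → ℝ) → ℝ) (Q : Cube n) (x : Fin n → ℝ), x ∈ Q.toSet →
        ∑ R ∈ F1 with Q.toSet ⊆ R.toSet, osc f R ^ 2 ≤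
          ∑ R ∈ F1, osc f R ^ 2 * R.toSet.indicator (fun _ => 1) x := by
      intro f Q x hx
      rw [Finset.sum_filter]
      refine Finset.sum_le_sum fun R _ => ?_
      split_ifs with h
      · simp [h hx]
      · exact mul_nonneg (sq_nonneg _) (Set.indicator_nonneg (fun _ _ => zero_le_one) x)
    have hsub : U ⊆ {x ∈ P.toSet | 2 ^ n * A ^ 2 * avg (fun x => |b' x|) P ^ 2 <
          ∑ Q ∈ F1, osc b' Q ^ 2 * Q.toSet.indicator (fun _ => 1) x} ∪
        {x ∈ P.toSet | 2 ^ n * A ^ 2 * avg (fun x => |g x|) P ^ 2 <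
          ∑ Q ∈ F1, osc g Q ^ 2 * Q.toSet.indicator (fun _ => 1) x} := by
      intro x hx
      have hxP := hUP hx
      obtain ⟨Q, hQ, hxQ⟩ := Set.mem_iUnion₂.1 hx
      rcases (Finset.mem_filter.1 hQ).2 with h | h
      · refine Or.inl ⟨hxP, lt_of_lt_of_le h ?_⟩
        refine (hle b Q x hxQ).trans (le_of_eq ?_)
        refine Finset.sum_congr rfl fun R hR => ?_
        rw [hosc R (Finset.mem_filter.1 hR).1]
      · exact Or.inr ⟨hxP, lt_of_lt_of_le h (hle g Q x hxQ)⟩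
    refine (measureReal_mono hsub (measure_ne_top_of_subset
      (Set.union_subset (Set.sep_subset _ _) (Set.sep_subset _ _)) P.volume_ne_top)).trans ?_
    refine (measureReal_union_le _ _).trans ((add_le_add h1 h2).trans (le_of_eq ?_))
    rw [hA]; field_simp; ring
  -- Since `θ < 1`, the stopped set cannot exhaust `P`. Thus `P` itself is among the absorbed cubes
  -- and the family strictly shrinks.
  have hPZ : ∀ R ∈ Z, ¬ P.toSet ⊆ R.toSet := by
    intro R hR h
    have h1 : vol P ≤ volume.real U :=
      measureReal_mono (h.trans (Set.subset_biUnion_of_mem (u := Cube.toSet) (Finset.mem_coe.2 hR)))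
        (measure_ne_top_of_subset hUP P.volume_ne_top)
    nlinarith [vol_pos P]
  set F4 := {Q ∈ F1 | ∀ R ∈ Z, ¬ Q.toSet ⊆ R.toSet} with hF4
  have hPF4 : P ∈ F4 :=
    Finset.mem_filter.2 ⟨Finset.mem_filter.2 ⟨hPF, subset_rfl⟩, hPZ⟩
  have hF4F : F4 ⊆ F := (Finset.filter_subset _ _).trans (Finset.filter_subset _ _)
  have hss : F \ F4 ⊂ F :=
    Finset.ssubset_iff_subset_ne.2 ⟨Finset.sdiff_subset, fun h => by
      have := h ▸ hPF
      exact (Finset.mem_sdiff.1 this).2 hPF4⟩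
  obtain ⟨S, E, hSF, ⟨hE, hEd⟩, hdom⟩ := ih _ hss fun Q hQ => hF Q (Finset.mem_sdiff.1 hQ).1
  have hPS : P ∉ S := fun h => (Finset.mem_sdiff.1 (hSF h)).2 hPF4
  -- A remaining cube meeting `P` lies inside it, as `P` has the largest scale, and not having been
  -- absorbed it lies inside a stopped cube.
  have hdisj : ∀ Q ∈ S, Disjoint Q.toSet (P.toSet \ U) := by
    intro Q hQ
    obtain ⟨hQF, hQ4⟩ := Finset.mem_sdiff.1 (hSF hQ)
    refine Set.disjoint_left.2 fun x hxQ hx => ?_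
    have hQP : Q.toSet ⊆ P.toSet :=
      D.subset_of_scale_le hn (hF Q hQF) hPD (hPmax Q hQF) hxQ hx.1
    have h1 : ∃ R ∈ Z, Q.toSet ⊆ R.toSet := by
      by_contra! h
      exact hQ4 (Finset.mem_filter.2 ⟨Finset.mem_filter.2 ⟨hQF, hQP⟩, h⟩)
    obtain ⟨R, hR, hQR⟩ := h1
    exact hx.2 (Set.mem_biUnion (Finset.mem_coe.2 hR) (hQR hxQ))
  have hne' : ∀ Q ∈ S, Q ≠ P := fun Q hQ h => hPS (h ▸ hQ)
  refine ⟨insert P S, Function.update E P (P.toSet \ U), ?_, ⟨?_, ?_⟩, fun x => ?_⟩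
  · exact Finset.insert_subset hPF (hSF.trans Finset.sdiff_subset)
  · intro Q hQ
    rcases Finset.mem_insert.1 (Finset.mem_coe.1 hQ) with rfl | hQ
    · rw [Function.update_self]
      refine ⟨Q.measurableSet.diff hUm, Set.sdiff_subset, ?_⟩
      have hfin : volume (Q.toSet \ U) ≠ ∞ :=
        measure_ne_top_of_subset Set.sdiff_subset Q.volume_ne_top
      rw [Q.volume_eq, ← ENNReal.ofReal_mul (by linarith), ← ofReal_measureReal hfin]
      refine ENNReal.ofReal_le_ofReal ?_
      rw [measureReal_sdiff hUP hUm Q.volume_ne_top]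
      change _ ≤ vol Q - _
      linarith
    · rw [Function.update_of_ne (hne' Q hQ)]
      exact hE Q hQ
  · rw [Finset.coe_insert, Set.pairwiseDisjoint_insert]
    refine ⟨fun Q hQ R hR hne => ?_, fun Q hQ _ => ?_⟩
    · simp only [Function.onFun]
      rw [Function.update_of_ne (hne' Q hQ), Function.update_of_ne (hne' R hR)]
      exact hEd hQ hR hne
    · rw [Function.update_self, Function.update_of_ne (hne' Q hQ)]
      exact ((hdisj Q hQ).mono_left (hE Q hQ).2.1).symm
  · rw [Finset.sum_insert hPS, mul_add, ← Finset.sum_sdiff hF4F, add_comm]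
    refine add_le_add ?_ (hdom x)
    have hm := meanOsc_nonneg b P
    have hav := avg_nonneg (fun x => abs_nonneg (g x)) P
    have hrhs : 0 ≤ 16 * 2 ^ n / θ ^ 2 * (meanOsc b P * avg (fun x => |g x|) P) := by positivity
    have hsum : ∑ Q ∈ F4, osc b Q * osc g Q * Q.toSet.indicator (fun _ => 1) x =
        ∑ Q ∈ F4 with x ∈ Q.toSet, osc b Q * osc g Q := by
      rw [Finset.sum_filter fun Q : Cube n => x ∈ Q.toSet]
      refine Finset.sum_congr rfl fun Q _ => ?_
      by_cases hx : x ∈ Q.toSet <;> simp [hx]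
    rw [hsum]
    set W := {Q ∈ F4 | x ∈ Q.toSet} with hW
    rcases W.eq_empty_or_nonempty with hWe | hWne
    · rw [hWe, Finset.sum_empty, ← mul_assoc]
      exact mul_nonneg hrhs (Set.indicator_nonneg (fun _ _ => zero_le_one) x)
    -- The absorbed cubes through `x` form a chain. They all contain its smallest member `Q0`, which
    -- is not stopped, so both sums of squares over the chain are below the thresholds and
    -- Cauchy–Schwarz applies.
    obtain ⟨Q0, hQ0, hmin⟩ := W.exists_min_image Cube.scale hWne
    obtain ⟨hQ04, hxQ0⟩ := Finset.mem_filter.1 hQ0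
    obtain ⟨hQ01, hQ0Z⟩ := Finset.mem_filter.1 hQ04
    have hxP : x ∈ P.toSet := (hF1D Q0 hQ01).2 hxQ0
    have hQ0n : ¬ (tb < ∑ R ∈ F1 with Q0.toSet ⊆ R.toSet, osc b R ^ 2 ∨
        tg < ∑ R ∈ F1 with Q0.toSet ⊆ R.toSet, osc g R ^ 2) := fun h =>
      hQ0Z Q0 (Finset.mem_filter.2 ⟨hQ01, h⟩) subset_rfl
    push Not at hQ0n
    have hWsub : W ⊆ {R ∈ F1 | Q0.toSet ⊆ R.toSet} := by
      intro R hR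
      obtain ⟨hR4, hxR⟩ := Finset.mem_filter.1 hR
      have hR1 := (Finset.mem_filter.1 hR4).1
      exact Finset.mem_filter.2 ⟨hR1, D.subset_of_scale_le hn (hF1D Q0 hQ01).1 (hF1D R hR1).1
        (hmin R hR) hxQ0 hxR⟩
    have hWb := (Finset.sum_le_sum_of_subset_of_nonneg hWsub fun R _ _ =>
      sq_nonneg (osc b R)).trans hQ0n.1
    have hWg := (Finset.sum_le_sum_of_subset_of_nonneg hWsub fun R _ _ =>
      sq_nonneg (osc g R)).trans hQ0n.2
    rw [Set.indicator_of_mem hxP, mul_one]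
    refine (pow_le_pow_iff_left₀ (Finset.sum_nonneg fun Q _ => mul_nonneg (osc_nonneg b Q)
      (osc_nonneg g Q)) hrhs two_ne_zero).1 ?_
    refine (Finset.sum_mul_sq_le_sq_mul_sq W _ _).trans ?_
    refine (mul_le_mul hWb hWg (Finset.sum_nonneg fun _ _ => sq_nonneg _)
      (by rw [htb]; positivity)).trans (le_of_eq ?_)
    rw [htb, htg, hA]
    field_simp
    ring

end SparseDomination

/-! ### Sparse collections with prescribed Carleson constant -/

section Carleson

variable {n : ℕ}

/-- The part of the cube `P` where the `i`-th coordinate lies in the initial fraction `θ`. -/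
def slab (θ : ℝ) (i : Fin n) (P : Cube n) : Set (Fin n → ℝ) :=
  {x ∈ P.toSet | x i < P.corner i + θ * P.side}

theorem slab_subset (θ : ℝ) (i : Fin n) (P : Cube n) : slab θ i P ⊆ P.toSet := Set.sep_subset _ _

theorem measurableSet_slab (θ : ℝ) (i : Fin n) (P : Cube n) : MeasurableSet (slab θ i P) :=
  P.measurableSet.inter (measurableSet_lt (measurable_pi_apply i) measurable_const)

theorem volume_slab {θ : ℝ} (h0 : 0 ≤ θ) (h1 : θ ≤ 1) (i : Fin n) (P : Cube n) :
    volume (slab θ i P) = ENNReal.ofReal θ * volume P.toSet := by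
  have hp := P.side_pos
  have h : slab θ i P = Set.pi Set.univ fun j =>
      Set.Ico (P.corner j) (P.corner j + (if j = i then θ else 1) * P.side) := by
    ext x
    simp only [slab, Cube.toSet, Set.mem_ofPred_eq, Set.mem_pi, Set.mem_univ, forall_true_left,
      Set.mem_Ico]
    constructor
    · rintro ⟨hx, hxi⟩ j
      refine ⟨(hx j).1, ?_⟩
      split_ifs with hj
      · exact hj ▸ hxi
      · simpa using (hx j).2
    · intro hx
      refine ⟨fun j => ⟨(hx j).1, (hx j).2.trans_le ?_⟩, by simpa using (hx i).2⟩
      gcongr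
      split_ifs <;> nlinarith
  rw [h, Real.volume_pi_Ico, P.volume_eq, vol_eq, ← ENNReal.ofReal_mul h0]
  simp only [add_sub_cancel_left]
  rw [← ENNReal.ofReal_prod_of_nonneg fun j _ => by split_ifs <;> positivity,
    Finset.prod_mul_distrib]
  simp

/-- The maximal dyadic cubes contained in the slab of `P`. -/
def slabCubes (D : DyadicGrid n) (θ : ℝ) (i : Fin n) (P : Cube n) : Set (Cube n) :=
  maximalCubes {R ∈ D.cubes | R.toSet ⊆ slab θ i P}

/-- The strict inequality defining the slab leaves room for a small dyadic cube around each of its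
points. Hence a slab of any fraction `θ`, dyadic or not, is a union of dyadic cubes; this makes
every real Carleson constant attainable. -/
theorem biUnion_slabCubes (hn : n ≠ 0) (D : DyadicGrid n) {θ : ℝ} {i : Fin n} {P : Cube n}
    (hP : P ∈ D.cubes) : ⋃ R ∈ slabCubes D θ i P, R.toSet = slab θ i P := by
  rw [slabCubes, D.biUnion_maximalCubes hn (Set.sep_subset _ _) (K := P.scale)
    fun R hR => Cube.scale_le_of_subset hn (hR.2.trans (slab_subset θ i P))]
  refine subset_antisymm (Set.iUnion₂_subset fun R hR => hR.2) fun x hx => ?_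
  obtain ⟨N, hN⟩ := exists_pow_lt_of_lt_one (sub_pos.2 hx.2) (by norm_num : (1 / 2 : ℝ) < 1)
  obtain ⟨R, ⟨hR, hRs, hxR⟩, -⟩ := D.partition (min P.scale (-N)) x
  have hRP : R.toSet ⊆ P.toSet := D.subset_of_scale_le hn hR hP (by omega) hxR hx.1
  refine Set.mem_biUnion (show R ∈ {R ∈ D.cubes | R.toSet ⊆ slab θ i P} from
    ⟨hR, fun y hy => ⟨hRP hy, ?_⟩⟩) hxR
  have h1 : R.side ≤ (1 / 2) ^ N := by
    rw [Cube.side, hRs, one_div, inv_pow, ← zpow_natCast, ← zpow_neg]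
    exact zpow_le_zpow_right₀ (by norm_num) (min_le_right _ _)
  linarith [(hy i).2, (hxR i).1]

/-- The family generated from `Q` by the passage from a cube to the maximal cubes of its slab. -/
inductive Tower (D : DyadicGrid n) (θ : ℝ) (i : Fin n) (Q : Cube n) : Cube n → Prop
  | root : Tower D θ i Q Q
  | step {P R : Cube n} : Tower D θ i Q P → R ∈ slabCubes D θ i P → Tower D θ i Q R

namespace Tower

variable {D : DyadicGrid n} {θ : ℝ} {i : Fin n} {Q P R : Cube n}

theorem mem_cubes (hQ : Q ∈ D.cubes) (h : Tower D θ i Q P) : P ∈ D.cubes := by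
  cases h with
  | root => exact hQ
  | step _ hR => exact hR.1.1

theorem subset (h : Tower D θ i Q P) : P.toSet ⊆ Q.toSet := by
  induction h with
  | root => exact subset_rfl
  | step _ hR ih => exact (hR.1.2.trans (slab_subset _ _ _)).trans ih

theorem ne_of_mem_slabCubes (hθ0 : 0 ≤ θ) (hθ1 : θ < 1) (hR : R ∈ slabCubes D θ i P) : R ≠ P := by
  rintro rfl
  have h := measure_mono (μ := volume) hR.1.2
  rw [volume_slab hθ0 hθ1.le, R.volume_eq, ← ENNReal.ofReal_mul hθ0,
    ENNReal.ofReal_le_ofReal_iff (mul_nonneg hθ0 (vol_pos R).le)] at h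
  nlinarith [vol_pos R]

/-- Induction on the total depth of `P` and `R` below `Q`, through the cube `R'` from which `R` was
generated. It makes the sets `P \ slab P` pairwise disjoint over the tower. -/
theorem subset_slab (hn : n ≠ 0) (hθ0 : 0 ≤ θ) (hθ1 : θ < 1) (hQ : Q ∈ D.cubes) (N : ℕ) :
    ∀ P R, Tower D θ i Q P → Tower D θ i Q R → R.toSet ⊆ P.toSet → R ≠ P →
      2 * Q.scale - P.scale - R.scale ≤ N → R.toSet ⊆ slab θ i P := by
  induction N with
  | zero =>
    intro P R hP hR h hne hN
    have h1 := D.scale_lt_of_ne hn (hR.mem_cubes hQ) (hP.mem_cubes hQ) h hne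
    have h2 := Cube.scale_le_of_subset hn hP.subset
    push_cast at hN
    omega
  | succ N ih =>
    intro P R hP hR h hne hN
    cases hR with
    | root => exact absurd (D.eq_of_toSet_eq hn hQ (hP.mem_cubes hQ) (h.antisymm hP.subset)) hne
    | @step R' _ hR' hRR' =>
      have hRs : R.toSet ⊆ R'.toSet := hRR'.1.2.trans (slab_subset _ _ _)
      have h1 := D.scale_lt_of_ne hn hRR'.1.1 (hR'.mem_cubes hQ) hRs
        (ne_of_mem_slabCubes hθ0 hθ1 hRR')
      push_cast at hN
      rcases eq_or_ne R' P with rfl | hne'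
      · exact hRR'.1.2
      have hx1 := hRs R.corner_mem
      have hx2 := h R.corner_mem
      rcases le_total R'.scale P.scale with hs | hs
      · exact hRs.trans (ih P R' hP hR' (D.subset_of_scale_le hn (hR'.mem_cubes hQ)
          (hP.mem_cubes hQ) hs hx1 hx2) hne' (by omega))
      -- Here `P` lies strictly between `R` and `R'`, so by induction it lies in the slab of `R'`,
      -- contradicting the maximality of `R` there.
      · have h2 := ih R' P hR' hP (D.subset_of_scale_le hn (hP.mem_cubes hQ) (hR'.mem_cubes hQ)
          hs hx2 hx1) hne'.symm (by omega)
        exact absurd (hRR'.2 P ⟨hP.mem_cubes hQ, h2⟩ h).symm hne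

theorem disjoint_diff_slab (hn : n ≠ 0) (hθ0 : 0 ≤ θ) (hθ1 : θ < 1) (hQ : Q ∈ D.cubes)
    (hP : Tower D θ i Q P) (hR : Tower D θ i Q R) (hne : P ≠ R) :
    Disjoint (P.toSet \ slab θ i P) (R.toSet \ slab θ i R) := by
  have key : ∀ P R, Tower D θ i Q P → Tower D θ i Q R → R.toSet ⊆ P.toSet → R ≠ P →
      R.toSet ⊆ slab θ i P := fun P R hP hR h hne =>
    subset_slab hn hθ0 hθ1 hQ _ P R hP hR h hne (Int.self_le_toNat _)
  refine Set.disjoint_left.2 fun x hx hy => ?_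
  rcases le_total R.scale P.scale with hs | hs
  · exact hx.2 (key P R hP hR (D.subset_of_scale_le hn (hR.mem_cubes hQ) (hP.mem_cubes hQ) hs
      hy.1 hx.1) hne.symm hy.1)
  · exact hy.2 (key R P hR hP (D.subset_of_scale_le hn (hP.mem_cubes hQ) (hR.mem_cubes hQ) hs
      hx.1 hy.1) hne hx.1)

theorem volume_diff_slab (hθ0 : 0 ≤ θ) (hθ1 : θ < 1) (i : Fin n) (P : Cube n) :
    volume (P.toSet \ slab θ i P) = ENNReal.ofReal (1 - θ) * volume P.toSet := by
  rw [measure_sdiff (slab_subset θ i P) (measurableSet_slab θ i P).nullMeasurableSet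
    (measure_ne_top_of_subset (slab_subset θ i P) P.volume_ne_top), volume_slab hθ0 hθ1.le,
    ENNReal.ofReal_sub _ hθ0, ENNReal.sub_mul fun _ _ => P.volume_ne_top]
  simp

/-- What the sets `R \ slab R` miss in `P` lies in the slab of `P`, that is in its slab cubes, to
which the estimate for `k` applies; each generation gains a factor `θ`. -/
theorem volume_compl_le (hn : n ≠ 0) (hθ0 : 0 ≤ θ) (hθ1 : θ < 1) (hQ : Q ∈ D.cubes) (k : ℕ) :
    ∀ P, Tower D θ i Q P →
      volume (P.toSet \ ⋃ R ∈ {R | Tower D θ i Q R}, (R.toSet \ slab θ i R)) ≤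
        ENNReal.ofReal θ ^ k * volume P.toSet := by
  induction k with
  | zero => intro P _; simpa using measure_mono Set.sdiff_subset
  | succ k ih =>
    intro P hP
    have hPD := hP.mem_cubes hQ
    have hc : (slabCubes D θ i P).Countable := D.countable.mono fun R hR => hR.1.1
    have hd : (slabCubes D θ i P).PairwiseDisjoint Cube.toSet :=
      D.pairwiseDisjoint_maximalCubes hn (Set.sep_subset _ _)
    have hsub : P.toSet \ ⋃ R ∈ {R | Tower D θ i Q R}, (R.toSet \ slab θ i R) ⊆
        ⋃ S ∈ slabCubes D θ i P,
          (S.toSet \ ⋃ R ∈ {R | Tower D θ i Q R}, (R.toSet \ slab θ i R)) := by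
      rintro x ⟨hxP, hx⟩
      have h1 : x ∈ slab θ i P := by
        by_contra h
        exact hx (Set.mem_biUnion (show P ∈ {R | Tower D θ i Q R} from hP) ⟨hxP, h⟩)
      rw [← biUnion_slabCubes hn D hPD] at h1
      obtain ⟨S, hS, hxS⟩ := Set.mem_iUnion₂.1 h1
      exact Set.mem_biUnion hS ⟨hxS, hx⟩
    refine (measure_mono hsub).trans ((measure_biUnion_le _ hc _).trans ?_)
    refine (ENNReal.tsum_le_tsum fun S : slabCubes D θ i P => ih S.1 (hP.step S.2)).trans ?_
    rw [ENNReal.tsum_mul_left, ← measure_biUnion hc hd fun S _ => S.measurableSet,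
      biUnion_slabCubes hn D hPD, volume_slab hθ0 hθ1.le, pow_succ, mul_assoc]

/-- Letting `k → ∞`, the sets `P \ slab P`, of relative measure `1 - θ`, cover almost all of `Q`.
This is the lower bound for the Carleson sum over `Q`. -/
theorem volume_le_tsum (hn : n ≠ 0) (hθ0 : 0 ≤ θ) (hθ1 : θ < 1) (hQ : Q ∈ D.cubes) :
    volume Q.toSet ≤ ENNReal.ofReal (1 - θ) * ∑' P : {P | Tower D θ i Q P}, volume P.1.toSet := by
  set V := ⋃ R ∈ {R | Tower D θ i Q R}, (R.toSet \ slab θ i R) with hV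
  have h0 : volume (Q.toSet \ V) = 0 := by
    have h1 : Tendsto (fun k : ℕ => ENNReal.ofReal θ ^ k * volume Q.toSet) atTop (𝓝 0) := by
      have := ENNReal.Tendsto.mul_const (b := volume Q.toSet)
        (ENNReal.tendsto_pow_atTop_nhds_zero_of_lt_one (r := ENNReal.ofReal θ)
          (by simpa using hθ1)) (Or.inr Q.volume_ne_top)
      simpa using this
    exact le_antisymm (ge_of_tendsto' h1 fun k => volume_compl_le hn hθ0 hθ1 hQ k Q root)
      zero_le
  have hc : {R | Tower D θ i Q R}.Countable := D.countable.mono fun R hR => hR.mem_cubes hQ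
  calc volume Q.toSet ≤ volume (Q.toSet \ V) + volume V :=
        (measure_mono (Set.subset_sdiff_union _ _)).trans (measure_union_le _ _)
    _ = volume V := by rw [h0, zero_add]
    _ ≤ _ := measure_biUnion_le _ hc _
    _ = _ := by simp_rw [volume_diff_slab hθ0 hθ1, ENNReal.tsum_mul_left]

end Tower

/-- The elementary half of the equivalence of sparse and Carleson: each `|P|` is at most `L |E P|`,
and the disjoint sets `E P` with `P ⊆ Q` fit into `Q`. -/
theorem carlesonConst_le_of_sparseWitness (D : DyadicGrid n) {S : Set (Cube n)}
    (hS : S ⊆ D.cubes) {L : ℝ} (hL : 0 < L) {E : Cube n → Set (Fin n → ℝ)}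
    (hE : SparseWitness L⁻¹ S E) : carlesonConst D S ≤ ENNReal.ofReal L := by
  refine iSup₂_le fun Q _ => ENNReal.div_le_of_le_mul ?_
  have hLL : ENNReal.ofReal L * ENNReal.ofReal L⁻¹ = 1 := by
    rw [← ENNReal.ofReal_mul hL.le, mul_inv_cancel₀ hL.ne', ENNReal.ofReal_one]
  have hc : {P | P ∈ S ∧ P.toSet ⊆ Q.toSet}.Countable := D.countable.mono fun P hP => hS hP.1
  calc ∑' P : {P : Cube n // P ∈ S ∧ P.toSet ⊆ Q.toSet}, volume P.1.toSet
      ≤ ∑' P : {P : Cube n // P ∈ S ∧ P.toSet ⊆ Q.toSet}, ENNReal.ofReal L * volume (E P.1) := by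
        refine ENNReal.tsum_le_tsum fun P => ?_
        calc volume P.1.toSet
            = ENNReal.ofReal L * (ENNReal.ofReal L⁻¹ * volume P.1.toSet) := by
              rw [← mul_assoc, hLL, one_mul]
          _ ≤ _ := by gcongr; exact (hE.1 P.1 P.2.1).2.2
    _ = ENNReal.ofReal L * volume (⋃ P ∈ {P | P ∈ S ∧ P.toSet ⊆ Q.toSet}, E P) := by
        rw [ENNReal.tsum_mul_left, measure_biUnion hc (hE.2.subset fun P hP => hP.1)
          fun P hP => (hE.1 P hP.1).1]
        rfl
    _ ≤ _ := by
        gcongr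
        exact Set.iUnion₂_subset fun P hP => (hE.1 P hP.1).2.1.trans hP.2

/-- One goes far out in direction `i`. The scale is chosen at least as large as those in `S`, so
that a single number bounds all scales of the enlarged family. -/
theorem exists_cube_disjoint (D : DyadicGrid n) (i : Fin n) (S : Finset (Cube n)) :
    ∃ Q ∈ D.cubes, (∀ P ∈ S, P.scale ≤ Q.scale) ∧ ∀ P ∈ S, Disjoint P.toSet Q.toSet := by
  obtain ⟨K, hK⟩ := (S.finite_toSet.image Cube.scale).bddAbove
  obtain ⟨M, hM⟩ := (S.finite_toSet.image fun P => P.corner i + P.side).bddAbove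
  obtain ⟨Q, ⟨hQ, hQs, hxQ⟩, -⟩ := D.partition K fun _ => M + 2 ^ K
  refine ⟨Q, hQ, fun P hP => hQs ▸ hK (Set.mem_image_of_mem _ hP), fun P hP => ?_⟩
  refine Set.disjoint_left.2 fun y hyP hyQ => ?_
  have h1 := (hyP i).2
  have h2 : P.corner i + P.side ≤ M :=
    hM (Set.mem_image_of_mem (fun P : Cube n => P.corner i + P.side) hP)
  have h3 := (hyQ i).1
  have h4 := (hxQ i).2
  have h5 : Q.side = 2 ^ K := by rw [Cube.side, hQs]
  dsimp only at h4
  linarith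

open Classical in
/-- A finite sparse family is contained in a sparse collection without infinitely increasing chains
whose Carleson constant has a prescribed value. -/
theorem exists_mem_upsilon_carlesonConst_eq (hn : n ≠ 0) (D : DyadicGrid n) {L : ℝ} (hL : 1 < L)
    {S : Finset (Cube n)} (hS : ∀ Q ∈ S, Q ∈ D.cubes) {E : Cube n → Set (Fin n → ℝ)}
    (hE : SparseWitness L⁻¹ (S : Set (Cube n)) E) :
    ∃ S' ∈ Upsilon D, carlesonConst D S' = ENNReal.ofReal L ∧ (S : Set (Cube n)) ⊆ S' := by
  have hL0 : 0 < L := by linarith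
  have hLi0 : 0 < L⁻¹ := inv_pos.2 hL0
  have hLi1 : L⁻¹ < 1 := inv_lt_one_of_one_lt₀ hL
  have hθ0 : 0 ≤ 1 - L⁻¹ := by linarith
  have hθ1 : 1 - L⁻¹ < 1 := by linarith
  let i : Fin n := ⟨0, Nat.pos_of_ne_zero hn⟩
  -- With `θ = 1 - L⁻¹` the tower over `Q` is `L⁻¹`-sparse. As `Q` is disjoint from the cubes of
  -- `S`, the union with `S` is `L⁻¹`-sparse too.
  obtain ⟨Q, hQ, hscale, hdisj⟩ := exists_cube_disjoint D i S
  set T : Set (Cube n) := {P | Tower D (1 - L⁻¹) i Q P} with hT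
  set E' : Cube n → Set (Fin n → ℝ) := fun P =>
    if P ∈ S then E P else P.toSet \ slab (1 - L⁻¹) i P with hE'
  have hTS : ∀ P ∈ T, P ∉ S := fun P hP hPS =>
    Set.disjoint_left.1 (hdisj P hPS) P.corner_mem (hP.subset P.corner_mem)
  have hES : ∀ P ∈ S, E' P = E P := fun P hP => if_pos hP
  have hET : ∀ P ∈ T, E' P = P.toSet \ slab (1 - L⁻¹) i P := fun P hP => if_neg (hTS P hP)
  have hsub : (S : Set (Cube n)) ∪ T ⊆ D.cubes :=
    Set.union_subset (fun P hP => hS P hP) fun P hP => hP.mem_cubes hQ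
  have hST : ∀ P ∈ S, ∀ R ∈ T, Disjoint (E' P) (E' R) := by
    intro P hP R hR
    rw [hES P hP, hET R hR]
    exact (hdisj P hP).mono (hE.1 P hP).2.1 (Set.sdiff_subset.trans hR.subset)
  have hw : SparseWitness L⁻¹ ((S : Set (Cube n)) ∪ T) E' := by
    refine ⟨?_, ?_⟩
    · rintro P (hP | hP)
      · rw [hES P hP]
        exact hE.1 P hP
      · rw [hET P hP]
        refine ⟨P.measurableSet.diff (measurableSet_slab _ _ _), Set.sdiff_subset, ?_⟩
        rw [Tower.volume_diff_slab hθ0 hθ1, sub_sub_cancel]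
    · rintro P (hP | hP) R (hR | hR) hne
      · simp only [Function.onFun]
        rw [hES P hP, hES R hR]
        exact hE.2 hP hR hne
      · exact hST P hP R hR
      · exact (hST R hR P hP).symm
      · simp only [Function.onFun]
        rw [hET P hP, hET R hR]
        exact Tower.disjoint_diff_slab hn hθ0 hθ1 hQ hP hR hne
  refine ⟨(S : Set (Cube n)) ∪ T, ⟨hsub, ⟨L⁻¹, hLi0, hLi1, E', hw⟩, ?_⟩, ?_, Set.subset_union_left⟩
  · rintro ⟨P, hP⟩
    -- Along a strictly increasing chain the integer scales strictly increase, yet here they are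
    -- bounded by that of `Q`.
    have hb : ∀ k, (P k).scale ≤ Q.scale := fun k => by
      rcases (hP k).1 with h | h
      · exact hscale _ h
      · exact Cube.scale_le_of_subset hn h.subset
    have hinc : ∀ k : ℕ, (P 0).scale + k ≤ (P k).scale := by
      intro k
      induction k with
      | zero => simp
      | succ k ih =>
        have := D.scale_lt_of_ne hn (hsub (hP k).1) (hsub (hP (k + 1)).1) (hP k).2.subset
          fun h => (hP k).2.ne (congrArg _ h)
        push_cast
        omega
    have h1 := hinc (Q.scale - (P 0).scale + 1).toNat
    have h2 := hb (Q.scale - (P 0).scale + 1).toNat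
    omega
  -- Sparseness bounds the constant by `L`; the cube `Q`, with the tower alone, shows that `L` is
  -- attained.
  · refine le_antisymm (carlesonConst_le_of_sparseWitness D hsub hL0 hw) ?_
    refine le_trans ?_ (le_iSup₂ (f := fun Q _ => (∑' P : {P : Cube n //
      P ∈ (S : Set (Cube n)) ∪ T ∧ P.toSet ⊆ Q.toSet}, volume P.1.toSet) / volume Q.toSet) Q hQ)
    rw [ENNReal.le_div_iff_mul_le (Or.inl Q.volume_ne_zero) (Or.inl Q.volume_ne_top)]
    have h1 := Tower.volume_le_tsum (i := i) hn hθ0 hθ1 hQ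
    rw [sub_sub_cancel] at h1
    have h2 : ∑' P : T, volume P.1.toSet ≤ ∑' P : {P : Cube n //
        P ∈ (S : Set (Cube n)) ∪ T ∧ P.toSet ⊆ Q.toSet}, volume P.1.toSet :=
      ENNReal.tsum_mono_subtype (fun P : Cube n => volume P.toSet)
        (t := {P | P ∈ (S : Set (Cube n)) ∪ T ∧ P.toSet ⊆ Q.toSet})
        fun P hP => ⟨Or.inr hP, hP.subset⟩
    calc ENNReal.ofReal L * volume Q.toSet
        ≤ ENNReal.ofReal L * (ENNReal.ofReal L⁻¹ * ∑' P : T, volume P.1.toSet) := by gcongr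
      _ = ∑' P : T, volume P.1.toSet := by
        rw [← mul_assoc, ← ENNReal.ofReal_mul hL0.le, mul_inv_cancel₀ hL0.ne', ENNReal.ofReal_one,
          one_mul]
      _ ≤ _ := h2

end Carleson

/-! ### Unconditional convergence in `L^p` -/

section Unconditional

theorem abs_rpow_le_midpoint {p : ℝ} (hp : 1 < p) (a v : ℝ) :
    |a| ^ p ≤ (|a + v| ^ p + |a - v| ^ p) / 2 := by
  have h := (strictConvexOn_rpow hp).convexOn.2 (abs_nonneg (a + v)) (abs_nonneg (a - v))
    (by norm_num : (0 : ℝ) ≤ 1 / 2) (by norm_num : (0 : ℝ) ≤ 1 / 2) (by norm_num)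
  simp only [smul_eq_mul] at h
  have h1 : |a| ≤ 1 / 2 * |a + v| + 1 / 2 * |a - v| := by
    have := abs_add_le (a + v) (a - v)
    rw [show a + v + (a - v) = 2 * a by ring, abs_mul, abs_two] at this
    linarith
  have h2 := Real.rpow_le_rpow (abs_nonneg a) h1 (by linarith : 0 ≤ p)
  linarith

/-- Strict convexity of `x ^ p` on `[0, ∞)` says nothing when `|a + 1| = |a - 1|`. That happens only
at `a = 0`, where the inequality reads `0 < 1`. -/
theorem abs_rpow_lt_midpoint {p : ℝ} (hp : 1 < p) (a : ℝ) :
    |a| ^ p < (|a + 1| ^ p + |a - 1| ^ p) / 2 := by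
  rcases eq_or_ne (|a + 1|) (|a - 1|) with h | h
  · have ha : a = 0 := by
      rcases abs_eq_abs.1 h with h | h <;> linarith
    simp [ha, Real.zero_rpow (by linarith : p ≠ 0)]
  · have h3 := (strictConvexOn_rpow hp).2 (abs_nonneg (a + 1)) (abs_nonneg (a - 1)) h
      (by norm_num : (0 : ℝ) < 1 / 2) (by norm_num : (0 : ℝ) < 1 / 2) (by norm_num)
    simp only [smul_eq_mul] at h3
    have h1 : |a| ≤ 1 / 2 * |a + 1| + 1 / 2 * |a - 1| := by
      have := abs_add_le (a + 1) (a - 1)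
      rw [show a + 1 + (a - 1) = 2 * a by ring, abs_mul, abs_two] at this
      linarith
    have h2 := Real.rpow_le_rpow (abs_nonneg a) h1 (by linarith : 0 ≤ p)
    linarith

/-- A quantitative form of the uniform convexity of `|x| ^ p`. -/
theorem exists_abs_rpow_le {p : ℝ} (hp : 1 < p) {t : ℝ} (ht : 0 < t) :
    ∃ C : ℝ, 0 ≤ C ∧ ∀ a v : ℝ,
      |v| ^ p ≤ t * |a| ^ p + C * ((|a + v| ^ p + |a - v| ^ p) / 2 - |a| ^ p) := by
  have hp0 : 0 < p := by linarith
  -- By homogeneity `v = 1` suffices. For `|a| > M` the term `t * |a| ^ p` already exceeds `1`; for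
  -- `|a| ≤ M` the midpoint defect has a positive minimum `c` by compactness, and `C = c⁻¹` works.
  set M : ℝ := (1 / t) ^ (1 / p) with hM
  have hM0 : 0 ≤ M := by positivity
  have hcont : ContinuousOn (fun a : ℝ => (|a + 1| ^ p + |a - 1| ^ p) / 2 - |a| ^ p)
      (Set.Icc (-M) M) := by
    refine Continuous.continuousOn ?_
    have : ∀ f : ℝ → ℝ, Continuous f → Continuous fun a => |f a| ^ p := fun f hf =>
      (hf.abs).rpow_const fun _ => Or.inr hp0.le
    exact ((((this _ (continuous_id.add continuous_const)).add
      (this _ (continuous_id.sub continuous_const))).div_const 2)).sub (this _ continuous_id)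
  obtain ⟨a0, -, ha0⟩ := isCompact_Icc.exists_isMinOn ⟨0, by simpa using hM0⟩ hcont
  set c := (|a0 + 1| ^ p + |a0 - 1| ^ p) / 2 - |a0| ^ p with hc
  have hc0 : 0 < c := sub_pos.2 (abs_rpow_lt_midpoint hp a0)
  have key : ∀ a : ℝ, 1 ≤ t * |a| ^ p + c⁻¹ * ((|a + 1| ^ p + |a - 1| ^ p) / 2 - |a| ^ p) := by
    intro a
    have h0 : 0 ≤ (|a + 1| ^ p + |a - 1| ^ p) / 2 - |a| ^ p :=
      sub_nonneg.2 (abs_rpow_le_midpoint hp a 1)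
    by_cases ha : |a| ≤ M
    · have h1 : c ≤ (|a + 1| ^ p + |a - 1| ^ p) / 2 - |a| ^ p := ha0 (abs_le.1 ha)
      have h2 : 1 ≤ c⁻¹ * ((|a + 1| ^ p + |a - 1| ^ p) / 2 - |a| ^ p) := by
        rw [inv_mul_eq_div, le_div_iff₀ hc0]; linarith
      have : 0 ≤ t * |a| ^ p := by positivity
      linarith
    · have h1 : 1 / t ≤ |a| ^ p := by
        have := Real.rpow_le_rpow hM0 (not_le.1 ha).le hp0.le
        rwa [hM, ← Real.rpow_mul (by positivity), one_div_mul_cancel hp0.ne', Real.rpow_one] at this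
      have h2 : 1 ≤ t * |a| ^ p := by
        rw [div_le_iff₀ ht] at h1; linarith
      have : 0 ≤ c⁻¹ * ((|a + 1| ^ p + |a - 1| ^ p) / 2 - |a| ^ p) :=
        mul_nonneg (inv_nonneg.2 hc0.le) h0
      linarith
  refine ⟨c⁻¹, inv_nonneg.2 hc0.le, fun a v => ?_⟩
  rcases eq_or_ne v 0 with rfl | hv
  · simp only [abs_zero, Real.zero_rpow hp0.ne', add_zero, sub_zero]
    have : 0 ≤ t * |a| ^ p := by positivity
    linarith
  · have h := mul_le_mul_of_nonneg_left (key (a / v)) (Real.rpow_nonneg (abs_nonneg v) p)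
    have e : ∀ x : ℝ, |v| ^ p * |x / v| ^ p = |x| ^ p := by
      intro x
      rw [← Real.mul_rpow (abs_nonneg _) (abs_nonneg _), ← abs_mul, mul_div_cancel₀ _ hv]
    have e1 : a / v + 1 = (a + v) / v := by field_simp
    have e2 : a / v - 1 = (a - v) / v := by field_simp
    rw [e1, e2] at h
    calc |v| ^ p = |v| ^ p * 1 := (mul_one _).symm
      _ ≤ _ := h
      _ = t * (|v| ^ p * |a / v| ^ p) + c⁻¹ * ((|v| ^ p * |(a + v) / v| ^ p +
          |v| ^ p * |(a - v) / v| ^ p) / 2 - |v| ^ p * |a / v| ^ p) := by ring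
      _ = _ := by rw [e, e, e]

variable {E ι : Type} [MeasurableSpace E] {m : Measure E}

theorem memLp_signedSum {q : ℝ≥0∞} {u : ι → E → ℝ} (hu : ∀ i, MemLp (u i) q m) (F : Finset ι)
    (σ : ι → ℝ) : MemLp (fun x => ∑ i ∈ F, σ i * u i x) q m :=
  memLp_finsetSum F fun i _ => (hu i).const_mul (σ i)

/-- A series in `L^p`, `1 < p < ∞`, with bounded signed partial sums has small blocks. -/
theorem exists_finset_integral_lt {p : ℝ} (hp : 1 < p) {u : ι → E → ℝ}
    (hu : ∀ i, MemLp (u i) (ENNReal.ofReal p) m) {B : ℝ}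
    (hB : ∀ (F : Finset ι) (σ : ι → ℝ), (∀ i, σ i = 1 ∨ σ i = -1) →
      ∫ x, |∑ i ∈ F, σ i * u i x| ^ p ∂m ≤ B) {ε : ℝ} (hε : 0 < ε) :
    ∃ F : Finset ι, ∀ T : Finset ι, Disjoint T F → ∫ x, |∑ i ∈ T, u i x| ^ p ∂m < ε := by
  classical
  have hp0 : 0 < p := by linarith
  have hint : ∀ f : E → ℝ, MemLp f (ENNReal.ofReal p) m → Integrable (fun x => |f x| ^ p) m := by
    intro f hf
    have := hf.integrable_norm_rpow (by simpa using hp0) ENNReal.ofReal_ne_top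
    simpa [ENNReal.toReal_ofReal hp0.le] using this
  set X : Set ℝ := {y | ∃ (F : Finset ι) (σ : ι → ℝ), (∀ i, σ i = 1 ∨ σ i = -1) ∧
    ∫ x, |∑ i ∈ F, σ i * u i x| ^ p ∂m = y} with hX
  have hXne : X.Nonempty := ⟨_, ∅, fun _ => 1, fun _ => Or.inl rfl, rfl⟩
  have hXb : BddAbove X := ⟨B, by rintro _ ⟨F, σ, hσ, rfl⟩; exact hB F σ hσ⟩
  have hM0 : 0 ≤ sSup X := by
    obtain ⟨y, F, σ, hσ, rfl⟩ := hXne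
    exact (integral_nonneg fun x => by positivity).trans (le_csSup hXb ⟨F, σ, hσ, rfl⟩)
  obtain ⟨C, hC0, hC⟩ := exists_abs_rpow_le hp (t := ε / (2 * (sSup X + 1))) (by positivity)
  have hη : 0 < ε / (2 * (C + 1)) := by positivity
  -- `F` and its signs nearly attain the supremum of all signed sums. Adding or subtracting a block
  -- `v` disjoint from `F` gives signed sums again, which cannot exceed the supremum; hence the
  -- midpoint defect is small, and so is `v`.
  obtain ⟨_, ⟨F, σ, hσ, rfl⟩, hF⟩ := exists_lt_of_lt_csSup hXne (sub_lt_self _ hη)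
  refine ⟨F, fun T hT => ?_⟩
  set a : E → ℝ := fun x => ∑ i ∈ F, σ i * u i x with ha
  set v : E → ℝ := fun x => ∑ i ∈ T, u i x with hv
  have haL : MemLp a (ENNReal.ofReal p) m := memLp_signedSum hu F σ
  have hvL : MemLp v (ENNReal.ofReal p) m := memLp_finsetSum T fun i _ => hu i
  have hsg : ∀ s : ℝ, s = 1 ∨ s = -1 → ∫ x, |a x + s * v x| ^ p ∂m ≤ sSup X := by
    intro s hs
    refine le_csSup hXb ⟨F ∪ T, fun i => if i ∈ T then s else σ i, fun i => ?_, ?_⟩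
    · dsimp only
      split_ifs
      exacts [hs, hσ i]
    · congr 1
      ext x
      rw [Finset.sum_union hT.symm]
      congr 3
      · refine Finset.sum_congr rfl fun i hi => ?_
        dsimp only
        rw [if_neg (Finset.disjoint_right.1 hT hi)]
      · rw [hv, Finset.mul_sum]
        refine Finset.sum_congr rfl fun i hi => ?_
        dsimp only
        rw [if_pos hi]
  have h1 := hsg 1 (Or.inl rfl)
  have h2 := hsg (-1) (Or.inr rfl)
  simp only [one_mul, neg_mul, ← sub_eq_add_neg] at h1 h2
  have ia := hint a haL
  have i1 := hint _ (haL.add hvL)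
  have i2 := hint _ (haL.sub hvL)
  simp only [Pi.add_apply, Pi.sub_apply] at i1 i2
  have i12 : Integrable (fun x => (|a x + v x| ^ p + |a x - v x| ^ p) / 2) m :=
    (i1.add i2).div_const 2
  have i3 : Integrable (fun x => (|a x + v x| ^ p + |a x - v x| ^ p) / 2 - |a x| ^ p) m :=
    i12.sub ia
  have hle : ∫ x, |v x| ^ p ∂m ≤ ∫ x, (ε / (2 * (sSup X + 1)) * |a x| ^ p +
      C * ((|a x + v x| ^ p + |a x - v x| ^ p) / 2 - |a x| ^ p)) ∂m :=
    integral_mono (hint v hvL) ((ia.const_mul _).add (i3.const_mul C)) fun x => hC (a x) (v x)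
  rw [integral_add (ia.const_mul _) (i3.const_mul C), integral_const_mul, integral_const_mul,
    integral_sub i12 ia, integral_div, integral_add i1 i2] at hle
  have h3 : ∫ x, |a x| ^ p ∂m ≤ sSup X := le_csSup hXb ⟨F, σ, hσ, rfl⟩
  have h4 : ε / (2 * (sSup X + 1)) * ∫ x, |a x| ^ p ∂m ≤ ε / 2 * (sSup X / (sSup X + 1)) := by
    calc _ ≤ ε / (2 * (sSup X + 1)) * sSup X := by gcongr
      _ = _ := by field_simp
  have h5 : C * ((∫ x, |a x + v x| ^ p ∂m + ∫ x, |a x - v x| ^ p ∂m) / 2 - ∫ x, |a x| ^ p ∂m) ≤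
      C * (ε / (2 * (C + 1))) := by
    gcongr
    linarith
  have h6 : C * (ε / (2 * (C + 1))) ≤ ε / 2 := by
    rw [mul_div_assoc', div_le_div_iff₀ (by positivity) (by norm_num)]
    nlinarith
  have h7 : ε / 2 * (sSup X / (sSup X + 1)) < ε / 2 := by
    have : sSup X / (sSup X + 1) < 1 := by
      rw [div_lt_one (by linarith)]; linarith
    nlinarith
  linarith

/-- Small blocks are the Cauchy criterion for unconditional summability in the complete space `L^p`.
The norm bound passes to the limit from the partial sums with all signs `+1`. -/
theorem exists_hasLpSum {p : ℝ} (hp : 1 < p) {u : ι → E → ℝ}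
    (hu : ∀ i, MemLp (u i) (ENNReal.ofReal p) m) {B : ℝ≥0∞} (hBt : B ≠ ∞)
    (hB : ∀ (F : Finset ι) (σ : ι → ℝ), (∀ i, σ i = 1 ∨ σ i = -1) →
      eLpNorm (fun x => ∑ i ∈ F, σ i * u i x) (ENNReal.ofReal p) m ≤ B) :
    ∃ g, HasLpSum m (ENNReal.ofReal p) u g ∧ eLpNorm g (ENNReal.ofReal p) m ≤ B := by
  have hp0 : 0 < p := by linarith
  have hq0 : ENNReal.ofReal p ≠ 0 := by simpa using hp0
  have : Fact (1 ≤ ENNReal.ofReal p) := ⟨by simpa using hp.le⟩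
  have hnorm : ∀ f : E → ℝ, MemLp f (ENNReal.ofReal p) m →
      eLpNorm f (ENNReal.ofReal p) m = ENNReal.ofReal ((∫ x, |f x| ^ p ∂m) ^ p⁻¹) := by
    intro f hf
    rw [hf.eLpNorm_eq_integral_rpow_norm hq0 ENNReal.ofReal_ne_top]
    simp [ENNReal.toReal_ofReal hp0.le]
  set U : ι → Lp ℝ (ENNReal.ofReal p) m := fun i => (hu i).toLp (u i) with hU
  have hUsum : ∀ F : Finset ι, (∑ i ∈ F, U i : Lp ℝ (ENNReal.ofReal p) m) =ᵐ[m]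
      fun x => ∑ i ∈ F, u i x := by
    intro F
    have h1 : ∀ᵐ x ∂m, ∀ i ∈ F, U i x = u i x :=
      (ae_ball_iff F.countable_toSet).2 fun i _ => (hu i).coeFn_toLp
    filter_upwards [Lp.coeFn_finsetSum F U, h1] with x hx h1
    rw [hx, Finset.sum_apply]
    exact Finset.sum_congr rfl h1
  have hUn : ∀ F : Finset ι, ‖∑ i ∈ F, U i‖ = (∫ x, |∑ i ∈ F, u i x| ^ p ∂m) ^ p⁻¹ := by
    intro F
    rw [Lp.norm_def, eLpNorm_congr_ae (hUsum F), hnorm _ (memLp_finsetSum F fun i _ => hu i),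
      ENNReal.toReal_ofReal (by positivity)]
  have hbound : ∀ (F : Finset ι) (σ : ι → ℝ), (∀ i, σ i = 1 ∨ σ i = -1) →
      ∫ x, |∑ i ∈ F, σ i * u i x| ^ p ∂m ≤ B.toReal ^ p := by
    intro F σ hσ
    have h := hB F σ hσ
    rw [hnorm _ (memLp_signedSum hu F σ), ENNReal.ofReal_le_iff_le_toReal hBt] at h
    have h2 := Real.rpow_le_rpow (by positivity) h hp0.le
    rwa [← Real.rpow_mul (by positivity), inv_mul_cancel₀ hp0.ne', Real.rpow_one] at h2
  have hsum : Summable U := by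
    rw [summable_iff_vanishing_norm]
    intro ε hε
    obtain ⟨F, hF⟩ := exists_finset_integral_lt hp hu hbound (Real.rpow_pos_of_pos hε p)
    refine ⟨F, fun T hT => ?_⟩
    rw [hUn]
    have := Real.rpow_lt_rpow (by positivity) (hF T hT) (inv_pos.2 hp0)
    rwa [← Real.rpow_mul hε.le, mul_inv_cancel₀ hp0.ne', Real.rpow_one] at this
  obtain ⟨G, hG⟩ := hsum
  refine ⟨G, ⟨Lp.memLp G, ?_⟩, ?_⟩
  · have h := (Lp.tendsto_Lp_iff_tendsto_eLpNorm' _ _).1 (show Tendsto _ atTop (𝓝 G) from hG)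
    refine h.congr fun F => eLpNorm_congr_ae ?_
    filter_upwards [hUsum F] with x hx
    rw [Pi.sub_apply, hx]
  · have h : ‖G‖ ≤ B.toReal := by
      refine le_of_tendsto hG.norm (Eventually.of_forall fun F => ?_)
      rw [Lp.norm_def, eLpNorm_congr_ae (hUsum F)]
      refine ENNReal.toReal_mono hBt ?_
      simpa using hB F (fun _ => 1) fun _ => Or.inl rfl
    rw [Lp.norm_def] at h
    exact (ENNReal.toReal_le_toReal (Lp.memLp G).2.ne hBt).1 h

/-- Hölder's inequality with the factor of the dual exponent cancelled. -/
theorem eLpNorm_le_of_lintegral_rpow_le {p : ℝ} (hp : 1 < p) {h A : E → ℝ}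
    (hh : MemLp h (ENNReal.ofReal p) m) (hA : AEStronglyMeasurable A m) {C : ℝ≥0∞}
    (hle : ∫⁻ x, ‖h x‖ₑ ^ p ∂m ≤ C * ∫⁻ x, ‖A x‖ₑ * ‖h x‖ₑ ^ (p - 1) ∂m) :
    eLpNorm h (ENNReal.ofReal p) m ≤ C * eLpNorm A (ENNReal.ofReal p) m := by
  have hp0 : 0 < p := by linarith
  have hq0 : ENNReal.ofReal p ≠ 0 := by simpa using hp0
  have hpq := Real.HolderConjugate.conjExponent hp
  have htop := hh.2.ne
  rw [eLpNorm_eq_lintegral_rpow_enorm_toReal hq0 ENNReal.ofReal_ne_top,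
    ENNReal.toReal_ofReal hp0.le] at htop
  rw [eLpNorm_eq_lintegral_rpow_enorm_toReal hq0 ENNReal.ofReal_ne_top,
    eLpNorm_eq_lintegral_rpow_enorm_toReal hq0 ENNReal.ofReal_ne_top,
    ENNReal.toReal_ofReal hp0.le]
  set X := ∫⁻ x, ‖h x‖ₑ ^ p ∂m with hX
  have hXt : X ≠ ∞ := fun h => htop (by rw [h, ENNReal.top_rpow_of_pos (by positivity)])
  rcases eq_or_ne X 0 with h0 | h0
  · rw [h0, ENNReal.zero_rpow_of_pos (by positivity)]
    exact zero_le
  have hH := ENNReal.lintegral_mul_rpow_le_lintegral_rpow_mul_lintegral_rpow (μ := m) hpq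
    hA.enorm hh.1.enorm
  have h1 : X ≤ C * ((∫⁻ x, ‖A x‖ₑ ^ p ∂m) ^ (1 / p)) * X ^ (1 / p.conjExponent) := by
    rw [mul_assoc]
    exact hle.trans (by gcongr)
  have hsplit : X = X ^ (1 / p) * X ^ (1 / p.conjExponent) := by
    rw [← ENNReal.rpow_add _ _ h0 hXt, one_div, one_div, hpq.inv_add_inv_eq_one,
      ENNReal.rpow_one]
  have hc0 : X ^ (1 / p.conjExponent) ≠ 0 := by simp [h0, hXt]
  have hct : X ^ (1 / p.conjExponent) ≠ ∞ := by simp [h0, hXt]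
  nth_rewrite 1 [hsplit] at h1
  exact (ENNReal.mul_le_mul_iff_left hc0 hct).1 h1

end Unconditional

/-! ### Weights -/

section Weights

variable {n : ℕ} {D : DyadicGrid n} {p : ℝ} {w mu lam b f : (Fin n → ℝ) → ℝ} {Q : Cube n}

theorem IsWeight.aemeasurable (hw : IsWeight w) : AEMeasurable w :=
  hw.1.aestronglyMeasurable.aemeasurable

/-- Positivity of `w` makes null sets and measurability for `w dx` transfer back to Lebesgue
measure. -/
theorem IsWeight.absolutelyContinuous (hw : IsWeight w) : volume ≪ wMeasure w :=
  withDensity_absolutelyContinuous' hw.aemeasurable.ennreal_ofReal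
    (hw.2.mono fun x hx => by simpa using hx)

theorem IsWeight.lintegral_wMeasure (hw : IsWeight w) {g : (Fin n → ℝ) → ℝ≥0∞}
    (hg : AEMeasurable g) : ∫⁻ x, g x ∂wMeasure w = ∫⁻ x, ENNReal.ofReal (w x) * g x :=
  lintegral_withDensity_eq_lintegral_mul₀ hw.aemeasurable.ennreal_ofReal hg

theorem IsWeight.wMeasure_cube_ne_top (hw : IsWeight w) (Q : Cube n) :
    wMeasure w Q.toSet ≠ ∞ := by
  rw [wMeasure, withDensity_apply _ Q.measurableSet]
  have h : Integrable w (volume.restrict Q.toSet) := hw.1.integrableOn_cube Q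
  exact (Integrable.lintegral_lt_top h).ne

/-- The `A_p` product is finite and its factor `⟨w⟩_Q` is positive, so the other factor cannot be
infinite. -/
theorem IsApWeight.lintegral_conjWeight_ne_top (hp : 1 < p) (hw : IsApWeight D p w)
    (hQ : Q ∈ D.cubes) : ∫⁻ x in Q.toSet, ENNReal.ofReal (conjWeight p w x) ≠ ∞ := by
  have h0 := hw.2
  rw [apChar] at h0
  have h1 := (le_iSup₂ Q hQ).trans_lt h0
  have h2 : (∫⁻ x in Q.toSet, ENNReal.ofReal (w x)) ≠ 0 := by
    intro h
    have h3 : wMeasure w Q.toSet = 0 := by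
      rw [wMeasure, withDensity_apply _ Q.measurableSet, h]
    exact Q.volume_ne_zero (hw.1.absolutelyContinuous h3)
  intro h
  rw [h, ENNReal.top_div_of_ne_top Q.volume_ne_top, ENNReal.top_rpow_of_pos (by linarith),
    ENNReal.mul_top (ENNReal.div_ne_zero.2 ⟨h2, Q.volume_ne_top⟩)] at h1
  exact lt_irrefl _ h1

/-- Hölder's inequality: the `p'`-th power of `w ^ (-1/p)` is the conjugate weight. Both `f = (f
w^(1/p)) w^(-1/p)` and `ν = μ^(1/p) λ^(-1/p)` have this form, which yields their integrability on
cubes. -/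
theorem IsApWeight.lintegral_mul_rpow_neg_lt_top (hp : 1 < p) (hw : IsApWeight D p w)
    (hQ : Q ∈ D.cubes) {F : (Fin n → ℝ) → ℝ≥0∞} (hF : AEMeasurable F)
    (hFp : ∫⁻ x in Q.toSet, F x ^ p ≠ ∞) :
    ∫⁻ x in Q.toSet, F x * ENNReal.ofReal (w x ^ (-(1 / p))) < ∞ := by
  have hp0 : 0 < p := by linarith
  have hpq := Real.HolderConjugate.conjExponent hp
  have hq0 : 0 < p.conjExponent := hpq.symm.pos
  have hG : AEMeasurable (fun x => ENNReal.ofReal (w x ^ (-(1 / p)))) :=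
    (hw.1.aemeasurable.pow_const _).ennreal_ofReal
  refine (ENNReal.lintegral_mul_le_Lp_mul_Lq (volume.restrict Q.toSet) hpq hF.restrict
    hG.restrict).trans_lt (ENNReal.mul_lt_top ?_ ?_)
  · exact ENNReal.rpow_lt_top_of_nonneg (by positivity) hFp
  · refine ENNReal.rpow_lt_top_of_nonneg (by positivity) ?_
    convert hw.lintegral_conjWeight_ne_top hp hQ using 1
    refine lintegral_congr_ae (ae_restrict_of_ae ?_)
    filter_upwards [hw.1.2] with x hx
    rw [ENNReal.ofReal_rpow_of_nonneg (by positivity) hq0.le, conjWeight, ← Real.rpow_mul hx.le]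
    congr 2
    have := hpq.sub_one_mul_conj
    field_simp
    linarith

theorem IsApWeight.integrableOn_of_memLp (hp : 1 < p) (hw : IsApWeight D p w)
    (hQ : Q ∈ D.cubes) (hf : MemLp f (ENNReal.ofReal p) (wMeasure w)) :
    IntegrableOn f Q.toSet := by
  have hp0 : 0 < p := by linarith
  have hfm : AEStronglyMeasurable f volume := hf.1.mono_ac hw.1.absolutelyContinuous
  have hFm : AEMeasurable (fun x => ‖f x‖ₑ * ENNReal.ofReal (w x ^ (1 / p))) :=
    hfm.enorm.mul (hw.1.aemeasurable.pow_const _).ennreal_ofReal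
  refine ⟨hfm.restrict, ?_⟩
  have h1 : ∫⁻ x in Q.toSet, (‖f x‖ₑ * ENNReal.ofReal (w x ^ (1 / p))) ^ p ≠ ∞ := by
    have h2 := (lintegral_rpow_enorm_lt_top_of_eLpNorm_lt_top (by simpa using hp0)
      ENNReal.ofReal_ne_top hf.2).ne
    rw [ENNReal.toReal_ofReal hp0.le, hw.1.lintegral_wMeasure (hfm.enorm.pow_const p)] at h2
    refine ne_top_of_le_ne_top h2 ((setLIntegral_le_lintegral _ _).trans
      (lintegral_mono_ae ?_))
    filter_upwards [hw.1.2] with x hx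
    rw [ENNReal.mul_rpow_of_nonneg _ _ hp0.le,
      ENNReal.ofReal_rpow_of_nonneg (by positivity) hp0.le, ← Real.rpow_mul hx.le,
      one_div_mul_cancel hp0.ne', Real.rpow_one, mul_comm]
  refine lt_of_eq_of_lt ?_ (hw.lintegral_mul_rpow_neg_lt_top hp hQ hFm h1)
  refine lintegral_congr_ae (ae_restrict_of_ae ?_)
  filter_upwards [hw.1.2] with x hx
  rw [mul_assoc, ← ENNReal.ofReal_mul (by positivity), ← Real.rpow_add hx, add_neg_cancel,
    Real.rpow_zero, ENNReal.ofReal_one, mul_one]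

theorem aemeasurable_bloomWeight (hmu : IsWeight mu) (hlam : IsWeight lam) :
    AEMeasurable (bloomWeight p mu lam) :=
  (hmu.aemeasurable.pow_const _).mul (hlam.aemeasurable.pow_const _)

theorem ae_bloomWeight_pos (hmu : IsWeight mu) (hlam : IsWeight lam) :
    ∀ᵐ x, 0 < bloomWeight p mu lam x := by
  filter_upwards [hmu.2, hlam.2] with x h1 h2
  exact mul_pos (Real.rpow_pos_of_pos h1 _) (Real.rpow_pos_of_pos h2 _)

theorem integrableOn_bloomWeight (hp : 1 < p) (hmu : IsWeight mu) (hlam : IsApWeight D p lam)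
    (hQ : Q ∈ D.cubes) : IntegrableOn (bloomWeight p mu lam) Q.toSet := by
  have hp0 : 0 < p := by linarith
  refine ⟨(aemeasurable_bloomWeight hmu hlam.1).aestronglyMeasurable.restrict, ?_⟩
  have h1 : ∫⁻ x in Q.toSet, ENNReal.ofReal (mu x ^ (1 / p)) ^ p ≠ ∞ := by
    have h : Integrable mu (volume.restrict Q.toSet) := hmu.1.integrableOn_cube Q
    convert h.lintegral_lt_top.ne using 1
    refine lintegral_congr_ae (ae_restrict_of_ae ?_)
    filter_upwards [hmu.2] with x hx
    rw [ENNReal.ofReal_rpow_of_nonneg (by positivity) hp0.le, ← Real.rpow_mul hx.le,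
      one_div_mul_cancel hp0.ne', Real.rpow_one]
  refine lt_of_eq_of_lt ?_ (hlam.lintegral_mul_rpow_neg_lt_top hp hQ
    (hmu.aemeasurable.pow_const _).ennreal_ofReal h1)
  refine lintegral_congr_ae (ae_restrict_of_ae ?_)
  filter_upwards [hmu.2, hlam.1.2] with x hx hx'
  rw [← ENNReal.ofReal_mul (by positivity), bloomWeight, Real.enorm_eq_ofReal
    (mul_nonneg (by positivity) (by positivity))]

theorem avg_bloomWeight_nonneg (hmu : IsWeight mu) (hlam : IsWeight lam) (Q : Cube n) :
    0 ≤ avg (bloomWeight p mu lam) Q := by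
  rw [avg_eq]
  exact mul_nonneg (inv_nonneg.2 (vol_pos Q).le) (setIntegral_nonneg_of_ae
    ((ae_bloomWeight_pos hmu hlam).mono fun x hx => hx.le))

theorem meanOsc_le_of_memBMO (hp : 1 < p) (hmu : IsWeight mu) (hlam : IsApWeight D p lam)
    (hb : MemBMO D (bloomWeight p mu lam) b) (hQ : Q ∈ D.cubes) :
    meanOsc b Q ≤ (bmoNorm D (bloomWeight p mu lam) b).toReal * avg (bloomWeight p mu lam) Q := by
  set ν := bloomWeight p mu lam
  have h1 : (∫⁻ x in Q.toSet, ENNReal.ofReal |b x - avg b Q|) / wMeasure ν Q.toSet ≤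
      bmoNorm D ν b :=
    le_iSup₂ (f := fun Q _ => (∫⁻ x in Q.toSet, ENNReal.ofReal |b x - avg b Q|) /
      wMeasure ν Q.toSet) Q hQ
  have hνi := integrableOn_bloomWeight hp hmu hlam hQ
  have hν0 := avg_bloomWeight_nonneg (p := p) hmu hlam.1 Q
  have hac : volume ≪ wMeasure ν := withDensity_absolutelyContinuous'
    (aemeasurable_bloomWeight hmu hlam.1).ennreal_ofReal
    ((ae_bloomWeight_pos hmu hlam.1).mono fun x hx => by simpa using hx)
  have hbi : Integrable (fun x => |b x - avg b Q|) (volume.restrict Q.toSet) :=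
    ((hb.1.integrableOn_cube Q).sub (integrableOn_const Q.volume_ne_top)).abs
  have ht : wMeasure ν Q.toSet ≠ ∞ := by
    rw [wMeasure, withDensity_apply _ Q.measurableSet]
    exact (Integrable.lintegral_lt_top hνi).ne
  have h0 : wMeasure ν Q.toSet ≠ 0 := fun h => Q.volume_ne_zero (hac h)
  rw [ENNReal.div_le_iff_le_mul (Or.inl h0) (Or.inl ht), wMeasure,
    withDensity_apply _ Q.measurableSet,
    ← ofReal_integral_eq_lintegral_ofReal hνi
      (ae_restrict_of_ae ((ae_bloomWeight_pos hmu hlam.1).mono fun x hx => hx.le)),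
    ← ofReal_integral_eq_lintegral_ofReal hbi (ae_of_all _ fun x => abs_nonneg _), ← ENNReal.ofReal_toReal hb.2.ne,
    ← ENNReal.ofReal_mul ENNReal.toReal_nonneg, setIntegral_eq_vol_mul_avg,
    setIntegral_eq_vol_mul_avg, ENNReal.ofReal_le_ofReal_iff (mul_nonneg ENNReal.toReal_nonneg
      (mul_nonneg (vol_pos Q).le hν0))] at h1
  change vol Q * meanOsc b Q ≤ _ at h1
  rw [mul_left_comm] at h1
  exact le_of_mul_le_mul_left h1 (vol_pos Q)

theorem IsWeight.memLp_of_abs_le (hw : IsWeight w) {q : ℝ≥0∞} {h : (Fin n → ℝ) → ℝ}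
    (hm : Measurable h) {Q : Cube n} {c : ℝ}
    (hle : ∀ x, |h x| ≤ c * Q.toSet.indicator (fun _ => 1) x) : MemLp h q (wMeasure w) := by
  have h1 : MemLp (Q.toSet.indicator fun _ => (1 : ℝ)) q (wMeasure w) :=
    memLp_indicator_const q Q.measurableSet 1 (Or.inr (hw.wMeasure_cube_ne_top Q))
  exact (h1.const_mul c).mono' hm.aestronglyMeasurable (ae_of_all _ hle)

end Weights

/-! ### Domination of the paraproducts by sparse operators -/

section Paraproducts

variable {n : ℕ} {D : DyadicGrid n} {p L : ℝ} {mu lam b : (Fin n → ℝ) → ℝ}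

/-! ### Integrals against finite combinations of indicators of cubes. -/

theorem measurable_sum_indicator (S : Finset (Cube n)) (a : Cube n → ℝ) :
    Measurable fun x => ∑ P ∈ S, a P * P.toSet.indicator (fun _ => (1 : ℝ)) x :=
  Finset.measurable_sum _ fun P _ =>
    (measurable_const.indicator P.measurableSet).const_mul _

theorem integrable_mul_indicator {g : (Fin n → ℝ) → ℝ} {P : Cube n} (hg : IntegrableOn g P.toSet)
    (a : ℝ) : Integrable fun x => g x * (a * P.toSet.indicator (fun _ => (1 : ℝ)) x) := by
  refine (((integrable_indicator_iff P.measurableSet).2 hg).const_mul a).congr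
    (ae_of_all _ fun x => ?_)
  by_cases hx : x ∈ P.toSet <;> simp [hx, mul_comm]

theorem integral_mul_indicator (g : (Fin n → ℝ) → ℝ) (P : Cube n) (a : ℝ) :
    ∫ x, g x * (a * P.toSet.indicator (fun _ => (1 : ℝ)) x) = a * (vol P * avg g P) := by
  rw [← setIntegral_eq_vol_mul_avg, ← integral_indicator P.measurableSet, ← integral_const_mul]
  refine integral_congr_ae (ae_of_all _ fun x => ?_)
  by_cases hx : x ∈ P.toSet <;> simp [hx, mul_comm]

theorem integral_mul_sum_indicator {g : (Fin n → ℝ) → ℝ} {S : Finset (Cube n)}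
    (hg : ∀ P ∈ S, IntegrableOn g P.toSet) (a : Cube n → ℝ) :
    ∫ x, g x * ∑ P ∈ S, a P * P.toSet.indicator (fun _ => (1 : ℝ)) x =
      ∑ P ∈ S, a P * (vol P * avg g P) := by
  simp_rw [Finset.mul_sum]
  rw [integral_finsetSum _ fun P hP => integrable_mul_indicator (hg P hP) _]
  simp_rw [integral_mul_indicator]

theorem integrable_mul_sum_indicator {g : (Fin n → ℝ) → ℝ} {S : Finset (Cube n)}
    (hg : ∀ P ∈ S, IntegrableOn g P.toSet) (a : Cube n → ℝ) :
    Integrable fun x => g x * ∑ P ∈ S, a P * P.toSet.indicator (fun _ => (1 : ℝ)) x := by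
  simp_rw [Finset.mul_sum]
  exact integrable_finsetSum _ fun P hP => integrable_mul_indicator (hg P hP) _

/-- The domination with `θ = 1 - L⁻¹`, for which `1 / θ = L / (L - 1)` and the family is
`L⁻¹`-sparse. The oscillations of `b` become averages of the Bloom weight, and the family is
embedded in an admissible one. -/
theorem exists_sparse_domination_bloom (hn : n ≠ 0) (hp : 1 < p) (hL : 1 < L)
    (hmu : IsWeight mu) (hlam : IsApWeight D p lam) (hb : MemBMO D (bloomWeight p mu lam) b)
    {g : (Fin n → ℝ) → ℝ} (hg : ∀ Q ∈ D.cubes, IntegrableOn g Q.toSet) {F : Finset (Cube n)}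
    (hF : ∀ Q ∈ F, Q ∈ D.cubes) :
    ∃ S : Finset (Cube n), (∀ Q ∈ S, Q ∈ D.cubes) ∧
      (∃ S' ∈ Upsilon D, carlesonConst D S' = ENNReal.ofReal L ∧ (S : Set (Cube n)) ⊆ S') ∧
      ∀ x, ∑ Q ∈ F, osc b Q * osc g Q * Q.toSet.indicator (fun _ => 1) x ≤
        16 * 2 ^ n * (bmoNorm D (bloomWeight p mu lam) b).toReal * (L / (L - 1)) ^ 2 *
          ∑ P ∈ S, avg (bloomWeight p mu lam) P * avg (fun x => |g x|) P *
            P.toSet.indicator (fun _ => 1) x := by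
  have hL0 : 0 < L := by linarith
  have hLi0 : 0 < L⁻¹ := inv_pos.2 hL0
  have hLi1 : L⁻¹ < 1 := inv_lt_one_of_one_lt₀ hL
  obtain ⟨S, E, hSF, hE, hdom⟩ := exists_sparse_domination hn D
    (fun Q _ => hb.1.integrableOn_cube Q) hg (θ := 1 - L⁻¹) (by linarith) (by linarith) F hF
  rw [sub_sub_cancel] at hE
  have hSD : ∀ Q ∈ S, Q ∈ D.cubes := fun Q hQ => hF Q (hSF hQ)
  refine ⟨S, hSD, exists_mem_upsilon_carlesonConst_eq hn D hL hSD hE, fun x => ?_⟩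
  refine (hdom x).trans ?_
  have h1 : (16 * 2 ^ n / (1 - L⁻¹) ^ 2 : ℝ) = 16 * 2 ^ n * (L / (L - 1)) ^ 2 := by
    have : L - 1 ≠ 0 := by linarith
    field_simp
  have h2 : ∑ P ∈ S, meanOsc b P * avg (fun x => |g x|) P * P.toSet.indicator (fun _ => 1) x ≤
      (bmoNorm D (bloomWeight p mu lam) b).toReal * ∑ P ∈ S, avg (bloomWeight p mu lam) P *
        avg (fun x => |g x|) P * P.toSet.indicator (fun _ => 1) x := by
    rw [Finset.mul_sum]
    refine Finset.sum_le_sum fun P hP => ?_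
    rw [← mul_assoc, ← mul_assoc]
    exact mul_le_mul_of_nonneg_right (mul_le_mul_of_nonneg_right
      (meanOsc_le_of_memBMO hp hmu hlam hb (hSD P hP)) (avg_nonneg (fun x => abs_nonneg _) P))
      (Set.indicator_nonneg (fun _ _ => zero_le_one) x)
  rw [h1, mul_right_comm _ (ENNReal.toReal _), mul_assoc _ (ENNReal.toReal _)]
  exact mul_le_mul_of_nonneg_left h2 (by positivity)

/-- Finite partial sums of a sparse operator are controlled by its norm. -/
theorem eLpNorm_sum_le_opNorm (hp : 1 < p) (hmu : IsApWeight D p mu) (hlam : IsWeight lam)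
    {S : Finset (Cube n)} {S' : Set (Cube n)} (hSS : (S : Set (Cube n)) ⊆ S')
    {f : (Fin n → ℝ) → ℝ} (hf : MemLp f (ENNReal.ofReal p) (wMeasure mu)) :
    eLpNorm (fun x => ∑ P ∈ S, avg (bloomWeight p mu lam) P * avg (fun x => |f x|) P *
        P.toSet.indicator (fun _ => 1) x) (ENNReal.ofReal p) (wMeasure lam) ≤
      opNorm p mu lam (sparseOp (bloomWeight p mu lam) S') *
        eLpNorm f (ENNReal.ofReal p) (wMeasure mu) := by
  classical
  have hp0 : 0 < p := by linarith
  have hp1 : 1 ≤ ENNReal.ofReal p := by simpa using hp.le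
  set A : (Fin n → ℝ) → ℝ := fun x => ∑ P ∈ S, avg (bloomWeight p mu lam) P *
    avg (fun x => |f x|) P * P.toSet.indicator (fun _ => 1) x with hA
  -- For `f = 0` the right side may be `∞ * 0 = 0`, so the left side is shown to vanish directly;
  -- otherwise one divides by the norm of `f`.
  rcases eq_or_ne (eLpNorm f (ENNReal.ofReal p) (wMeasure mu)) 0 with h0 | h0
  · have hf0 : f =ᵐ[volume] 0 := hmu.1.absolutelyContinuous.ae_eq
      ((eLpNorm_eq_zero_iff hf.1 (by simpa using hp0)).1 h0)
    have havg : ∀ P : Cube n, avg (fun x => |f x|) P = 0 := by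
      intro P
      rw [avg_eq, integral_eq_zero_of_ae, mul_zero]
      refine ae_restrict_of_ae ?_
      filter_upwards [hf0] with x hx
      simp [hx]
    have : A = 0 := by
      ext x
      simp [hA, havg]
    rw [this]
    simp
  · rw [← ENNReal.div_le_iff h0 hf.2.ne]
    refine le_sInf fun K hK => ?_
    rw [ENNReal.div_le_iff h0 hf.2.ne]
    obtain ⟨g, ⟨hg, hlim⟩, hgK⟩ := hK (fun x => |f x|) hf.abs
    have hnorm : eLpNorm (fun x => |f x|) (ENNReal.ofReal p) (wMeasure mu) =
        eLpNorm f (ENNReal.ofReal p) (wMeasure mu) := eLpNorm_norm f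
    rw [hnorm] at hgK
    refine le_trans ?_ hgK
    set t : S' → (Fin n → ℝ) → ℝ := fun i =>
      sparseOp (bloomWeight p mu lam) S' i (fun x => |f x|) with ht
    have ht0 : ∀ i x, 0 ≤ t i x := fun i x =>
      mul_nonneg (mul_nonneg (avg_bloomWeight_nonneg hmu.1 hlam _)
        (avg_nonneg (fun x => abs_nonneg _) _)) (Set.indicator_nonneg (fun _ _ => zero_le_one) x)
    have htm : ∀ i, Measurable (t i) := fun i =>
      (measurable_const.indicator i.1.measurableSet).const_mul _
    have hlim' : Tendsto (fun F : Finset S' => eLpNorm (fun x => (∑ i ∈ F, t i x) - g x)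
        (ENNReal.ofReal p) (wMeasure lam) + eLpNorm g (ENNReal.ofReal p) (wMeasure lam)) atTop
        (𝓝 (0 + eLpNorm g (ENNReal.ofReal p) (wMeasure lam))) := hlim.add tendsto_const_nhds
    rw [zero_add] at hlim'
    refine ge_of_tendsto hlim' ?_
    -- The terms for `|f|` are nonnegative, so every partial sum of the big series that contains `S`
    -- dominates the sum over `S`.
    filter_upwards [eventually_ge_atTop (S.subtype (· ∈ S'))] with F hF
    have h1 : ∀ x, ‖A x‖ ≤ ∑ i ∈ F, t i x := by
      intro x
      have h2 : A x = ∑ i ∈ S.subtype (· ∈ S'), t i x :=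
        (Finset.sum_subtype_of_mem (fun P => avg (bloomWeight p mu lam) P *
          avg (fun x => |f x|) P * P.toSet.indicator (fun _ => (1 : ℝ)) x)
          fun P hP => hSS hP).symm
      rw [h2, Real.norm_of_nonneg (Finset.sum_nonneg fun i _ => ht0 i x)]
      exact Finset.sum_le_sum_of_subset_of_nonneg hF fun i _ _ => ht0 i x
    refine (eLpNorm_mono_real h1).trans ?_
    have hsm : AEStronglyMeasurable (fun x => ∑ i ∈ F, t i x) (wMeasure lam) :=
      (Finset.measurable_sum F fun i _ => htm i).aestronglyMeasurable
    refine le_trans (le_of_eq ?_) (eLpNorm_add_le (hsm.sub hg.1) hg.1 hp1)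
    congr 1
    ext x
    simp

theorem ofReal_mul_eLpNorm_le_sparseSup (hp : 1 < p) (hmu : IsApWeight D p mu)
    (hlam : IsWeight lam) (hb : MemBMO D (bloomWeight p mu lam) b)
    {S : Finset (Cube n)} {S' : Set (Cube n)} (hS' : S' ∈ Upsilon D)
    (hS'L : carlesonConst D S' = ENNReal.ofReal L) (hSS : (S : Set (Cube n)) ⊆ S')
    {f : (Fin n → ℝ) → ℝ} (hf : MemLp f (ENNReal.ofReal p) (wMeasure mu)) :
    ENNReal.ofReal (16 * 2 ^ n * (bmoNorm D (bloomWeight p mu lam) b).toReal *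
        (L / (L - 1)) ^ 2) *
      eLpNorm (fun x => ∑ P ∈ S, avg (bloomWeight p mu lam) P * avg (fun x => |f x|) P *
        P.toSet.indicator (fun _ => 1) x) (ENNReal.ofReal p) (wMeasure lam) ≤
      ENNReal.ofReal (16 * 2 ^ n) * bmoNorm D (bloomWeight p mu lam) b *
        sparseSup D p L mu lam * eLpNorm f (ENNReal.ofReal p) (wMeasure mu) := by
  have h1 : ENNReal.ofReal ((L / (L - 1)) ^ 2) *
      opNorm p mu lam (sparseOp (bloomWeight p mu lam) S') ≤ sparseSup D p L mu lam :=
    le_iSup₂ (f := fun S (_ : S ∈ {S | S ∈ Upsilon D ∧ carlesonConst D S = ENNReal.ofReal L}) =>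
      ENNReal.ofReal ((L / (L - 1)) ^ 2) * opNorm p mu lam (sparseOp (bloomWeight p mu lam) S))
      S' ⟨hS', hS'L⟩
  rw [ENNReal.ofReal_mul (by positivity), ENNReal.ofReal_mul (by positivity),
    ENNReal.ofReal_toReal hb.2.ne]
  calc _ ≤ ENNReal.ofReal (16 * 2 ^ n) * bmoNorm D (bloomWeight p mu lam) b *
        ENNReal.ofReal ((L / (L - 1)) ^ 2) *
        (opNorm p mu lam (sparseOp (bloomWeight p mu lam) S') *
          eLpNorm f (ENNReal.ofReal p) (wMeasure mu)) := by
        gcongr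
        exact eLpNorm_sum_le_opNorm hp hmu hlam hSS hf
    _ = ENNReal.ofReal (16 * 2 ^ n) * bmoNorm D (bloomWeight p mu lam) b *
        (ENNReal.ofReal ((L / (L - 1)) ^ 2) *
        opNorm p mu lam (sparseOp (bloomWeight p mu lam) S')) *
          eLpNorm f (ENNReal.ofReal p) (wMeasure mu) := by ring
    _ ≤ _ := by gcongr

/-- The norm includes unconditional convergence of the series, which is why arbitrary signs must be
allowed. -/
theorem opNorm_le_of_signedSums (hp : 1 < p) {ι : Type}
    {t : ι → ((Fin n → ℝ) → ℝ) → (Fin n → ℝ) → ℝ} {M : ℝ≥0∞}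
    (ht : ∀ f, MemLp f (ENNReal.ofReal p) (wMeasure mu) → ∀ i,
      MemLp (t i f) (ENNReal.ofReal p) (wMeasure lam))
    (hM : ∀ f, MemLp f (ENNReal.ofReal p) (wMeasure mu) → ∀ (F : Finset ι) (σ : ι → ℝ),
      (∀ i, σ i = 1 ∨ σ i = -1) →
      eLpNorm (fun x => ∑ i ∈ F, σ i * t i f x) (ENNReal.ofReal p) (wMeasure lam) ≤
        M * eLpNorm f (ENNReal.ofReal p) (wMeasure mu)) :
    opNorm p mu lam t ≤ M := by
  rcases eq_or_ne M ∞ with rfl | hMt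
  · exact le_top
  · exact sInf_le fun f hf => exists_hasLpSum hp (ht f hf) (ENNReal.mul_ne_top hMt hf.2.ne)
      (hM f hf)

open Classical in
-- Each cube occurs with at most `Fintype.card κ` signature labels.
theorem sum_fst_le {κ : Type} [Fintype κ] {a : Cube n → ℝ} (ha : ∀ Q, 0 ≤ a Q)
    (F : Finset (D.cubes × κ)) :
    ∑ i ∈ F, a i.1.1 ≤ Fintype.card κ * ∑ Q ∈ F.image (fun i => i.1.1), a Q := by
  rw [← Finset.sum_fiberwise_of_maps_to (g := fun i : D.cubes × κ => i.1.1)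
    (t := F.image fun i => i.1.1) fun i hi => Finset.mem_image_of_mem _ hi, Finset.mul_sum]
  refine Finset.sum_le_sum fun Q _ => ?_
  rw [Finset.sum_congr rfl fun i hi => by rw [(Finset.mem_filter.1 hi).2], Finset.sum_const,
    nsmul_eq_mul]
  gcongr
  · exact ha Q
  · rw [← Finset.card_univ]
    refine Finset.card_le_card_of_injOn (fun i => i.2) (fun i _ => by simp) ?_
    intro i hi j hj hij
    have h1 := (Finset.mem_filter.1 (Finset.mem_coe.1 hi)).2
    have h2 := (Finset.mem_filter.1 (Finset.mem_coe.1 hj)).2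
    exact Prod.ext (Subtype.ext (h1.trans h2.symm)) hij

/-- Operators whose summands are pointwise bounded by products of oscillations. -/
theorem opNorm_le_of_abs_le_osc (hn : n ≠ 0) (hp : 1 < p) (hL : 1 < L)
    (hmu : IsApWeight D p mu) (hlam : IsApWeight D p lam)
    (hb : MemBMO D (bloomWeight p mu lam) b) {κ : Type} [Fintype κ]
    {t : D.cubes × κ → ((Fin n → ℝ) → ℝ) → (Fin n → ℝ) → ℝ}
    (htm : ∀ i f, Measurable (t i f))
    (ht : ∀ i f, IntegrableOn f i.1.1.toSet → ∀ x,
      |t i f x| ≤ osc b i.1.1 * osc f i.1.1 * i.1.1.toSet.indicator (fun _ => 1) x) :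
    opNorm p mu lam t ≤ Fintype.card κ * (ENNReal.ofReal (16 * 2 ^ n) *
      bmoNorm D (bloomWeight p mu lam) b * sparseSup D p L mu lam) := by
  classical
  refine opNorm_le_of_signedSums hp (fun f hf i => ?_) fun f hf F σ hσ => ?_
  · exact hlam.1.memLp_of_abs_le (htm i f) (ht i f (hmu.integrableOn_of_memLp hp i.1.2 hf))
  have hfi : ∀ Q ∈ D.cubes, IntegrableOn f Q.toSet := fun Q hQ =>
    hmu.integrableOn_of_memLp hp hQ hf
  obtain ⟨S, -, ⟨S', hS', hS'L, hSS⟩, hdom⟩ := exists_sparse_domination_bloom hn hp hL hmu.1 hlam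
    hb hfi (F := F.image fun i => i.1.1) fun Q hQ => by
      obtain ⟨i, -, rfl⟩ := Finset.mem_image.1 hQ
      exact i.1.2
  set c := 16 * 2 ^ n * (bmoNorm D (bloomWeight p mu lam) b).toReal * (L / (L - 1)) ^ 2 with hc
  set A : (Fin n → ℝ) → ℝ := fun x => ∑ P ∈ S, avg (bloomWeight p mu lam) P *
    avg (fun x => |f x|) P * P.toSet.indicator (fun _ => 1) x with hA
  have hpt : ∀ x, ‖∑ i ∈ F, σ i * t i f x‖ ≤ ((Fintype.card κ * c) • A) x := by
    intro x
    have hosc0 : ∀ Q : Cube n, 0 ≤ osc b Q * osc f Q * Q.toSet.indicator (fun _ => (1 : ℝ)) x :=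
      fun Q => mul_nonneg (mul_nonneg (osc_nonneg b Q) (osc_nonneg f Q))
        (Set.indicator_nonneg (fun _ _ => zero_le_one) x)
    calc ‖∑ i ∈ F, σ i * t i f x‖ ≤ ∑ i ∈ F, ‖σ i * t i f x‖ := norm_sum_le _ _
      _ ≤ ∑ i ∈ F, osc b i.1.1 * osc f i.1.1 * i.1.1.toSet.indicator (fun _ => 1) x := by
        refine Finset.sum_le_sum fun i _ => ?_
        have h1 : |σ i| = 1 := by rcases hσ i with h | h <;> simp [h]
        rw [Real.norm_eq_abs, abs_mul, h1, one_mul]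
        exact ht i f (hfi _ i.1.2) x
      _ ≤ Fintype.card κ * ∑ Q ∈ F.image (fun i => i.1.1),
          osc b Q * osc f Q * Q.toSet.indicator (fun _ => 1) x := sum_fst_le hosc0 F
      _ ≤ Fintype.card κ * (c * A x) := by gcongr; exact hdom x
      _ = _ := by simp [mul_assoc]
  refine (eLpNorm_mono_real hpt).trans ?_
  have hc0 : 0 ≤ c := by positivity
  rw [eLpNorm_const_smul, Real.enorm_eq_ofReal (by positivity), ENNReal.ofReal_mul (by positivity),
    ENNReal.ofReal_natCast, mul_assoc, mul_assoc]
  gcongr _ * ?_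
  exact ofReal_mul_eLpNorm_le_sparseSup hp hmu hlam.1 hb hS' hS'L hSS hf

theorem abs_pairing_mul_pairing_le {f : (Fin n → ℝ) → ℝ} {Q : Cube n}
    (hb : IntegrableOn b Q.toSet) (hf : IntegrableOn f Q.toSet) {e d : Signature n}
    (he : e.Cancellative) (hd : d.Cancellative) :
    |pairing b (haar Q e) * pairing f (haar Q d)| ≤ osc b Q * osc f Q * vol Q := by
  rw [abs_mul]
  refine (mul_le_mul (abs_pairing_haar_le hb he) (abs_pairing_haar_le hf hd) (abs_nonneg _)
    (mul_nonneg (Real.sqrt_nonneg _) (osc_nonneg b Q))).trans (le_of_eq ?_)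
  calc _ = osc b Q * osc f Q * (Real.sqrt (vol Q) * Real.sqrt (vol Q)) := by ring
    _ = _ := by rw [Real.mul_self_sqrt (vol_pos Q).le]

theorem abs_paraPiStar_le {f : (Fin n → ℝ) → ℝ} (i : HaarIndex D)
    (hb : IntegrableOn b i.1.1.toSet) (hf : IntegrableOn f i.1.1.toSet) (x : Fin n → ℝ) :
    |paraPiStar D b i f x| ≤
      osc b i.1.1 * osc f i.1.1 * i.1.1.toSet.indicator (fun _ => 1) x := by
  have hv := vol_pos i.1.1
  have h0 : 0 ≤ i.1.1.toSet.indicator (fun _ => (1 : ℝ)) x :=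
    Set.indicator_nonneg (fun _ _ => zero_le_one) x
  rw [paraPiStar, abs_mul, abs_of_nonneg (div_nonneg h0 hv.le)]
  refine (mul_le_mul_of_nonneg_right (abs_pairing_mul_pairing_le hb hf i.2.2 i.2.2)
    (div_nonneg h0 hv.le)).trans (le_of_eq ?_)
  field_simp

theorem abs_paraGamma_le {f : (Fin n → ℝ) → ℝ} (i : HaarPairIndex D)
    (hb : IntegrableOn b i.1.1.toSet) (hf : IntegrableOn f i.1.1.toSet) (x : Fin n → ℝ) :
    |paraGamma D b i f x| ≤
      osc b i.1.1 * osc f i.1.1 * i.1.1.toSet.indicator (fun _ => 1) x := by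
  have hv := vol_pos i.1.1
  have h0 : 0 ≤ i.1.1.toSet.indicator (fun _ => (1 : ℝ)) x :=
    Set.indicator_nonneg (fun _ _ => zero_le_one) x
  have h1 : |(Real.sqrt (vol i.1.1))⁻¹ * haar i.1.1 (sigAdd i.2.1.1 i.2.1.2) x| =
      i.1.1.toSet.indicator (fun _ => (1 : ℝ)) x / vol i.1.1 := by
    rw [abs_mul, abs_haar, abs_of_nonneg (by positivity), ← mul_assoc, ← mul_inv,
      Real.mul_self_sqrt hv.le, inv_mul_eq_div]
  rw [paraGamma, abs_mul, h1]
  refine (mul_le_mul_of_nonneg_right (abs_pairing_mul_pairing_le hb hf i.2.2.1 i.2.2.2.1)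
    (div_nonneg h0 hv.le)).trans (le_of_eq ?_)
  field_simp

end Paraproducts

/-! ### The paraproduct `Π_b` by duality -/

section Duality

variable {n : ℕ} {D : DyadicGrid n} {p L : ℝ} {mu lam b : (Fin n → ℝ) → ℝ}

open Classical in
/-- The bilinear form of a signed partial sum of `Π_b`. -/
theorem integral_signedSum_paraPi_mul_le (hb : ∀ Q ∈ D.cubes, IntegrableOn b Q.toSet)
    {f g : (Fin n → ℝ) → ℝ} (hf : ∀ Q ∈ D.cubes, IntegrableOn f Q.toSet)
    (hg : ∀ Q ∈ D.cubes, IntegrableOn g Q.toSet) [Fintype {e : Signature n // e.Cancellative}]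
    (F : Finset (HaarIndex D)) {σ : HaarIndex D → ℝ} (hσ : ∀ i, σ i = 1 ∨ σ i = -1) {c : ℝ}
    {S : Finset (Cube n)} {a : Cube n → ℝ} (hS : ∀ Q ∈ S, Q ∈ D.cubes)
    (hdom : ∀ x, ∑ Q ∈ F.image (fun i => i.1.1),
        osc b Q * osc g Q * Q.toSet.indicator (fun _ => 1) x ≤
      c * ∑ P ∈ S, a P * avg (fun x => |g x|) P * P.toSet.indicator (fun _ => 1) x) :
    Integrable (fun x => (∑ i ∈ F, σ i * paraPi D b i f x) * g x) ∧
    ∫ x, (∑ i ∈ F, σ i * paraPi D b i f x) * g x ≤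
      Fintype.card {e : Signature n // e.Cancellative} * (c *
        ∫ x, |g x| * ∑ P ∈ S, a P * avg (fun x => |f x|) P * P.toSet.indicator (fun _ => 1) x) := by
  set k : HaarIndex D → ℝ := fun i => σ i * (pairing b (haar i.1.1 i.2.1) * avg f i.1.1) with hk
  have heq : (fun x => (∑ i ∈ F, σ i * paraPi D b i f x) * g x) =
      fun x => ∑ i ∈ F, k i * (g x * haar i.1.1 i.2.1 x) := by
    ext x
    rw [Finset.sum_mul]
    refine Finset.sum_congr rfl fun i _ => ?_
    simp only [hk, paraPi]
    ring
  have hint : ∀ i : HaarIndex D, Integrable fun x => k i * (g x * haar i.1.1 i.2.1 x) := fun i =>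
    (integrable_mul_haar (hg _ i.1.2) i.2.1).const_mul _
  have hFD : ∀ Q ∈ F.image (fun i => i.1.1), Q ∈ D.cubes := fun Q hQ => by
    obtain ⟨i, -, rfl⟩ := Finset.mem_image.1 hQ
    exact i.1.2
  rw [heq]
  refine ⟨integrable_finsetSum _ fun i _ => hint i, ?_⟩
  rw [integral_finsetSum _ fun i _ => hint i]
  have hnn : ∀ Q : Cube n, 0 ≤ osc b Q * osc g Q * (vol Q * avg (fun x => |f x|) Q) := fun Q =>
    mul_nonneg (mul_nonneg (osc_nonneg b Q) (osc_nonneg g Q))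
      (mul_nonneg (vol_pos Q).le (avg_nonneg (fun x => abs_nonneg _) Q))
  calc ∑ i ∈ F, ∫ x, k i * (g x * haar i.1.1 i.2.1 x)
      ≤ ∑ i ∈ F, osc b i.1.1 * osc g i.1.1 * (vol i.1.1 * avg (fun x => |f x|) i.1.1) := by
        refine Finset.sum_le_sum fun i _ => ?_
        rw [integral_const_mul]
        change k i * pairing g (haar i.1.1 i.2.1) ≤ _
        refine (le_abs_self _).trans ?_
        have h1 : |σ i| = 1 := by rcases hσ i with h | h <;> simp [h]
        have h2 : |k i * pairing g (haar i.1.1 i.2.1)| =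
            |pairing b (haar i.1.1 i.2.1) * pairing g (haar i.1.1 i.2.1)| * |avg f i.1.1| := by
          simp only [hk, abs_mul, h1]
          ring
        rw [h2, ← mul_assoc]
        exact mul_le_mul (abs_pairing_mul_pairing_le (hb _ i.1.2) (hg _ i.1.2) i.2.2 i.2.2)
          (abs_avg_le _ _) (abs_nonneg _) (mul_nonneg (mul_nonneg (osc_nonneg b _)
            (osc_nonneg g _)) (vol_pos _).le)
    _ ≤ Fintype.card {e : Signature n // e.Cancellative} * ∑ Q ∈ F.image (fun i => i.1.1),
          osc b Q * osc g Q * (vol Q * avg (fun x => |f x|) Q) := sum_fst_le hnn F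
    _ ≤ _ := by
        refine mul_le_mul_of_nonneg_left ?_ (Nat.cast_nonneg _)
        have habs : ∀ Q ∈ D.cubes, IntegrableOn (fun x => |f x|) Q.toSet := fun Q hQ =>
          (hf Q hQ).abs
        have hgabs : ∀ Q ∈ D.cubes, IntegrableOn (fun x => |g x|) Q.toSet := fun Q hQ =>
          (hg Q hQ).abs
        -- The sum is read as an integral of `|f|` against the function dominated in `hdom`. After
        -- the domination the sparse form is symmetric in `|f|` and `|g|`, so the averaging moves
        -- from `g` to `f`.
        rw [← integral_mul_sum_indicator fun Q hQ => habs Q (hFD Q hQ),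
          integral_mul_sum_indicator fun Q hQ => hgabs Q (hS Q hQ)]
        have h3 : ∑ P ∈ S, a P * avg (fun x => |f x|) P * (vol P * avg (fun x => |g x|) P) =
            ∫ x, |f x| * ∑ P ∈ S, a P * avg (fun x => |g x|) P *
              P.toSet.indicator (fun _ => 1) x := by
          rw [integral_mul_sum_indicator fun Q hQ => habs Q (hS Q hQ)]
          refine Finset.sum_congr rfl fun P _ => by ring
        rw [h3, ← integral_const_mul]
        refine integral_mono
          (integrable_mul_sum_indicator (fun Q hQ => habs Q (hFD Q hQ)) _)
          ((integrable_mul_sum_indicator (fun Q hQ => habs Q (hS Q hQ)) _).const_mul _) fun x => ?_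
        dsimp only
        rw [mul_left_comm]
        exact mul_le_mul_of_nonneg_left (hdom x) (abs_nonneg _)

theorem abs_mul_abs_rpow_sub_two (hp : 1 < p) (y : ℝ) : |y| * |y| ^ (p - 2) = |y| ^ (p - 1) := by
  rcases eq_or_ne y 0 with rfl | hy
  · simp [Real.zero_rpow (by linarith : p - 1 ≠ 0)]
  · nth_rewrite 1 [← Real.rpow_one |y|]
    rw [← Real.rpow_add (abs_pos.2 hy)]
    congr 1; ring

open Classical in
theorem opNorm_paraPi_le (hn : n ≠ 0) (hp : 1 < p) (hL : 1 < L)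
    (hmu : IsApWeight D p mu) (hlam : IsApWeight D p lam)
    (hb : MemBMO D (bloomWeight p mu lam) b) :
    opNorm p mu lam (paraPi D b) ≤ Fintype.card {e : Signature n // e.Cancellative} *
      (ENNReal.ofReal (16 * 2 ^ n) * bmoNorm D (bloomWeight p mu lam) b *
        sparseSup D p L mu lam) := by
  have hp0 : 0 < p := by linarith
  have htm : ∀ i f, Measurable (paraPi D b i f) := fun i f => (measurable_haar _ _).const_mul _
  have hbd : ∀ i f x, |paraPi D b i f x| ≤ |pairing b (haar i.1.1 i.2.1) * avg f i.1.1| *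
      (Real.sqrt (vol i.1.1))⁻¹ * i.1.1.toSet.indicator (fun _ => 1) x := by
    intro i f x
    rw [paraPi, abs_mul, abs_haar, mul_assoc]
  have hML : ∀ i f, MemLp (paraPi D b i f) (ENNReal.ofReal p) (wMeasure lam) := fun i f =>
    hlam.1.memLp_of_abs_le (htm i f) (hbd i f)
  refine opNorm_le_of_signedSums hp (fun f _ i => hML i f) fun f hf F σ hσ => ?_
  have hfi : ∀ Q ∈ D.cubes, IntegrableOn f Q.toSet := fun Q hQ =>
    hmu.integrableOn_of_memLp hp hQ hf
  set h : (Fin n → ℝ) → ℝ := fun x => ∑ i ∈ F, σ i * paraPi D b i f x with hh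
  have hhL : MemLp h (ENNReal.ofReal p) (wMeasure lam) :=
    memLp_signedSum (fun i => hML i f) F σ
  have hhm : Measurable h := Finset.measurable_sum _ fun i _ => (htm i f).const_mul _
  -- A finite partial sum is bounded; hence the test function `g` below is locally integrable
  -- because `λ` is.
  obtain ⟨K, hK⟩ : ∃ K : ℝ, ∀ x, |h x| ≤ K := by
    refine ⟨∑ i ∈ F, |pairing b (haar i.1.1 i.2.1) * avg f i.1.1| * (Real.sqrt (vol i.1.1))⁻¹,
      fun x => (Finset.abs_sum_le_sum_abs _ _).trans (Finset.sum_le_sum fun i _ => ?_)⟩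
    have h1 : |σ i| = 1 := by rcases hσ i with h | h <;> simp [h]
    rw [abs_mul, h1, one_mul]
    refine (hbd i f x).trans (mul_le_of_le_one_right (by positivity) ?_)
    exact Set.indicator_le' (fun _ _ => le_rfl) (fun _ _ => zero_le_one) x
  -- The extremal dual function of `h` with the weight included, so that `∫ h g` is the `p`-th power
  -- of the norm of `h` in `L^p(λ)`. The sparse family obtained from it may depend on `h`, since the
  -- supremum covers all families.
  set g : (Fin n → ℝ) → ℝ := fun x => h x * |h x| ^ (p - 2) * lam x with hg
  have hgabs : ∀ x, |g x| = |h x| ^ (p - 1) * |lam x| := by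
    intro x
    rw [hg, abs_mul, abs_mul, abs_of_nonneg (by positivity : 0 ≤ |h x| ^ (p - 2)),
      abs_mul_abs_rpow_sub_two hp]
  have hhg : ∀ x, h x * g x = |h x| ^ p * lam x := by
    intro x
    have h1 : h x * (h x * |h x| ^ (p - 2)) = |h x| ^ p := by
      rw [← mul_assoc, ← abs_mul_abs_self, mul_assoc, abs_mul_abs_rpow_sub_two hp]
      rcases eq_or_ne (h x) 0 with h0 | h0
      · simp [h0, Real.zero_rpow hp0.ne']
      · nth_rewrite 1 [← Real.rpow_one |h x|]
        rw [← Real.rpow_add (abs_pos.2 h0)]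
        congr 1; ring
    rw [hg, ← h1]; ring
  have hgi : ∀ Q ∈ D.cubes, IntegrableOn g Q.toSet := by
    intro Q _
    have hlamQ : Integrable lam (volume.restrict Q.toSet) := hlam.1.1.integrableOn_cube Q
    refine (hlamQ.abs.const_mul (K ^ (p - 1))).mono' ?_ (ae_of_all _ fun x => ?_)
    · exact ((hhm.mul (hhm.abs.pow_const _)).aestronglyMeasurable).mul hlamQ.1
    · rw [Real.norm_eq_abs, hgabs]
      refine mul_le_mul_of_nonneg_right ?_ (abs_nonneg _)
      exact Real.rpow_le_rpow (abs_nonneg _) (hK x) (by linarith)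
  obtain ⟨S, hSD, ⟨S', hS', hS'L, hSS⟩, hdom⟩ := exists_sparse_domination_bloom hn hp hL hmu.1 hlam
    hb hgi (F := F.image fun i => i.1.1) fun Q hQ => by
      obtain ⟨i, -, rfl⟩ := Finset.mem_image.1 hQ
      exact i.1.2
  obtain ⟨hint, hle⟩ := integral_signedSum_paraPi_mul_le (fun Q _ => hb.1.integrableOn_cube Q)
    hfi hgi F hσ hSD hdom
  change Integrable (fun x => h x * g x) at hint
  change ∫ x, h x * g x ≤ _ at hle
  set c := 16 * 2 ^ n * (bmoNorm D (bloomWeight p mu lam) b).toReal * (L / (L - 1)) ^ 2 with hc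
  have hc0 : 0 ≤ c := by positivity
  set A : (Fin n → ℝ) → ℝ := fun x => ∑ P ∈ S, avg (bloomWeight p mu lam) P *
    avg (fun x => |f x|) P * P.toSet.indicator (fun _ => 1) x with hA
  have hAm : Measurable A := measurable_sum_indicator S _
  have hA0 : ∀ x, 0 ≤ A x := fun x => Finset.sum_nonneg fun P _ =>
    mul_nonneg (mul_nonneg (avg_bloomWeight_nonneg hmu.1 hlam.1 _)
      (avg_nonneg (fun x => abs_nonneg _) _)) (Set.indicator_nonneg (fun _ _ => zero_le_one) x)
  have hgAint : Integrable fun x => |g x| * A x :=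
    integrable_mul_sum_indicator (fun Q hQ => (hgi Q (hSD Q hQ)).abs) _
  have e1 : ∫⁻ x, ‖h x‖ₑ ^ p ∂wMeasure lam = ENNReal.ofReal (∫ x, h x * g x) := by
    rw [hlam.1.lintegral_wMeasure (hhm.enorm.pow_const p).aemeasurable,
      ofReal_integral_eq_lintegral_ofReal hint]
    · refine lintegral_congr_ae ?_
      filter_upwards [hlam.1.2] with x hx
      rw [hhg, Real.enorm_eq_ofReal_abs, ENNReal.ofReal_rpow_of_nonneg (abs_nonneg _) hp0.le,
        ← ENNReal.ofReal_mul hx.le, mul_comm]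
    · filter_upwards [hlam.1.2] with x hx
      rw [hhg, Pi.zero_apply]
      positivity
  have e2 : ∫⁻ x, ‖A x‖ₑ * ‖h x‖ₑ ^ (p - 1) ∂wMeasure lam =
      ENNReal.ofReal (∫ x, |g x| * A x) := by
    rw [hlam.1.lintegral_wMeasure (g := fun x => ‖A x‖ₑ * ‖h x‖ₑ ^ (p - 1))
        (hAm.enorm.mul (hhm.enorm.pow_const _)).aemeasurable,
      ofReal_integral_eq_lintegral_ofReal hgAint
        (ae_of_all _ fun x => mul_nonneg (abs_nonneg _) (hA0 x))]
    refine lintegral_congr_ae ?_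
    filter_upwards [hlam.1.2] with x hx
    rw [hgabs, Real.enorm_eq_ofReal (hA0 x), Real.enorm_eq_ofReal_abs,
      ENNReal.ofReal_rpow_of_nonneg (abs_nonneg _) (by linarith), ← ENNReal.ofReal_mul (hA0 x),
      ← ENNReal.ofReal_mul hx.le, abs_of_pos hx]
    congr 1; ring
  -- By `e1` and `e2` the bilinear estimate reads `∫ |h|^p λ ≤ C ∫ A |h|^(p-1) λ`, from which
  -- Hölder's inequality removes `|h|^(p-1)`.
  refine (eLpNorm_le_of_lintegral_rpow_le hp hhL hAm.aestronglyMeasurable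
    (C := Fintype.card {e : Signature n // e.Cancellative} * ENNReal.ofReal c) ?_).trans ?_
  · rw [e1, e2, ← ENNReal.ofReal_natCast, ← ENNReal.ofReal_mul (Nat.cast_nonneg _),
      ← ENNReal.ofReal_mul (by positivity), mul_assoc]
    exact ENNReal.ofReal_le_ofReal hle
  · rw [mul_assoc, mul_assoc]
    gcongr _ * ?_
    exact ofReal_mul_eLpNorm_le_sparseSup hp hmu hlam.1 hb hS' hS'L hSS hf

/-- The paraproducts are bounded by sparse operators. -/
theorem exists_forall_opNorm_paraproduct_le (n : ℕ) (hn : 1 ≤ n) :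
    ∃ C : NNReal, ∀ (D : DyadicGrid n) (p L : ℝ), 1 < p → 1 < L →
      ∀ mu lam : (Fin n → ℝ) → ℝ,
        IsApWeight D p mu → IsApWeight D p lam →
        ∀ b : (Fin n → ℝ) → ℝ,
          MemBMO D (bloomWeight p mu lam) b →
          opNorm p mu lam (paraPi D b) ≤
              C * bmoNorm D (bloomWeight p mu lam) b *
                sparseSup D p L mu lam ∧
          opNorm p mu lam (paraPiStar D b) ≤
              C * bmoNorm D (bloomWeight p mu lam) b *
                sparseSup D p L mu lam ∧
          opNorm p mu lam (paraGamma D b) ≤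
              C * bmoNorm D (bloomWeight p mu lam) b *
                sparseSup D p L mu lam := by
  classical
  have hn0 : n ≠ 0 := by omega
  -- `4 ^ n` bounds the number of cancellative signatures and of pairs of them; `16 * 2 ^ n` comes
  -- from the sparse domination.
  refine ⟨4 ^ n * (16 * 2 ^ n), fun D p L hp hL mu lam hmu hlam b hb => ?_⟩
  have hC : ∀ (k : ℕ) (x y z : ℝ≥0∞), k ≤ 4 ^ n → z ≤ k * (ENNReal.ofReal (16 * 2 ^ n) * x * y) →
      z ≤ ((4 ^ n * (16 * 2 ^ n) : ℝ≥0) : ℝ≥0∞) * x * y := by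
    intro k x y z hk hz
    refine hz.trans ?_
    have h1 : ENNReal.ofReal (16 * 2 ^ n) = 16 * 2 ^ n := by
      rw [ENNReal.ofReal_mul (by norm_num), ENNReal.ofReal_pow (by norm_num)]
      norm_num
    have h2 : (k : ℝ≥0∞) ≤ 4 ^ n := by exact_mod_cast hk
    rw [h1]
    push_cast
    rw [mul_assoc (4 ^ n : ℝ≥0∞), mul_assoc (4 ^ n : ℝ≥0∞)]
    gcongr
  have hsig : Fintype.card (Signature n) = 2 ^ n := by simp
  have h24 : 2 ^ n ≤ 4 ^ n := Nat.pow_le_pow_left (by norm_num) n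
  have hcard1 : Fintype.card {e : Signature n // e.Cancellative} ≤ 4 ^ n :=
    (Fintype.card_subtype_le _).trans (hsig ▸ h24)
  have hcard2 : Fintype.card {e : Signature n × Signature n //
      e.1.Cancellative ∧ e.2.Cancellative ∧ e.1 ≠ e.2} ≤ 4 ^ n := by
    refine (Fintype.card_subtype_le _).trans ?_
    rw [Fintype.card_prod, hsig, ← mul_pow]
    norm_num
  have hbi : ∀ Q : Cube n, IntegrableOn b Q.toSet := hb.1.integrableOn_cube
  refine ⟨hC _ _ _ _ hcard1 ?_, hC _ _ _ _ hcard1 ?_, hC _ _ _ _ hcard2 ?_⟩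
  · exact opNorm_paraPi_le hn0 hp hL hmu hlam hb
  · exact opNorm_le_of_abs_le_osc hn0 hp hL hmu hlam hb
      (fun i f => ((measurable_const.indicator i.1.1.measurableSet).div_const _).const_mul _)
      fun i f hf x => abs_paraPiStar_le i (hbi _) hf x
  · exact opNorm_le_of_abs_le_osc hn0 hp hL hmu hlam hb
      (fun i f => ((measurable_haar _ _).const_mul _).const_mul _)
      fun i f hf x => abs_paraGamma_le i (hbi _) hf x

end Duality

end BloomParaproduct

end

theorem mainTheorem7 (n : ℕ) (hn : 1 ≤ n) :
    ∃ C : NNReal, ∀ (D : BloomParaproduct.DyadicGrid n) (p L : ℝ), 1 < p → 1 < L →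
      ∀ mu lam : (Fin n → ℝ) → ℝ,
        BloomParaproduct.IsApWeight D p mu → BloomParaproduct.IsApWeight D p lam →
        ∀ b : (Fin n → ℝ) → ℝ,
          BloomParaproduct.MemBMO D (BloomParaproduct.bloomWeight p mu lam) b →
          BloomParaproduct.opNorm p mu lam (BloomParaproduct.paraPi D b) ≤
              C * BloomParaproduct.bmoNorm D (BloomParaproduct.bloomWeight p mu lam) b *
                BloomParaproduct.sparseSup D p L mu lam ∧
          BloomParaproduct.opNorm p mu lam (BloomParaproduct.paraPiStar D b) ≤
              C * BloomParaproduct.bmoNorm D (BloomParaproduct.bloomWeight p mu lam) b *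
                BloomParaproduct.sparseSup D p L mu lam ∧
          BloomParaproduct.opNorm p mu lam (BloomParaproduct.paraGamma D b) ≤
              C * BloomParaproduct.bmoNorm D (BloomParaproduct.bloomWeight p mu lam) b *
                BloomParaproduct.sparseSup D p L mu lam :=
  BloomParaproduct.exists_forall_opNorm_paraproduct_le n hn
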